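/- Let $a,b>0$ and let $g$ be the standard Euclidean Taub-NUT metric on $\mathbb{R}^4$, that is, the smooth complete Riemannian metric which in the coordinates $r=|x|^2$ and the Euler angles $(\theta,\varphi,\chi)$ of $S^3$ is $$f(r)\,(dr^2+r^2d\theta^2+r^2\sin^2\theta\,d\varphi^2)+h(r)\,(d\chi+\cos\theta\,d\varphi)^2,\qquad f(r)=\frac{a+br}{r},\quad h(r)=\frac{ar+br^2}{1+\frac{2b}{a}r+\frac{b^2}{a^2}r^2}.$$ Let $\Sigma_4=\Sigma_4^+\oplus\Sigma_4^-$ be the complex spinor bundle of the unique spin structure of $\mathbb{R}^4$, and let $D$ be the Dirac operator of $g$. If $\psi\in L^2(\mathbb{R}^4,\Sigma_4,g)$ satisfies $D\psi=0$ in the sense of distributions, then $\psi=0$. In particular the $L^2$-kernels of the chiral parts $D^{+}$ and $D^{-}$ of $D$ are finite-dimensional and the $L^2$-index $\dim\ker_{L^2}D^+-\dim\ker_{L^2}D^-$ (the axial anomaly) is $0$. -/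

import Mathlib

open MeasureTheory
open scoped ContDiff Matrix

noncomputable section

namespace TaubNUT

/-- The underlying manifold `ℝ⁴`. -/
abbrev E4 : Type := EuclideanSpace ℝ (Fin 4)

/-- The complex spinor space `Σ₄ = ℂ⁴` with its standard Hermitian inner product. -/
abbrev Spinor : Type := EuclideanSpace ℂ (Fin 4)

/-! ### Riemannian metrics on `ℝ⁴`, orthonormal frames, volume -/

/-- A smooth Riemannian metric on `ℝ⁴`, given by its matrix in the standard coordinates. -/
structure RiemannianMetric where
  toMatrix : E4 → Matrix (Fin 4) (Fin 4) ℝ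
  smooth : ∀ i j, ContDiff ℝ ∞ (fun x => toMatrix x i j)
  symm : ∀ x i j, toMatrix x i j = toMatrix x j i
  pos : ∀ x (v : E4), v ≠ 0 → 0 < ∑ i, ∑ j, toMatrix x i j * v i * v j

/-- The inner product `g_x(u, v)`. -/
def RiemannianMetric.inner (g : RiemannianMetric) (x u v : E4) : ℝ :=
  ∑ i, ∑ j, g.toMatrix x i j * u i * v j

/-- The Riemannian volume measure `√(det g) dx`. -/
def RiemannianMetric.vol (g : RiemannianMetric) : Measure E4 :=
  volume.withDensity fun x => ENNReal.ofReal (Real.sqrt (g.toMatrix x).det)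

/-- A smooth global orthonormal frame for `g`. -/
structure OrthonormalFrame (g : RiemannianMetric) where
  vec : Fin 4 → E4 → E4
  smooth : ∀ i, ContDiff ℝ ∞ (vec i)
  orthonormal : ∀ x i j, g.inner x (vec i x) (vec j x) = if i = j then 1 else 0

/-- The Levi-Civita connection coefficients `Γ i j k = g(∇_{e_i} e_j, e_k)` of an orthonormal
frame, by the Koszul formula. -/
def OrthonormalFrame.christoffel {g : RiemannianMetric} (e : OrthonormalFrame g)
    (i j k : Fin 4) (x : E4) : ℝ :=
  (1 / 2) * (g.inner x (VectorField.lieBracket ℝ (e.vec i) (e.vec j) x) (e.vec k x)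
    - g.inner x (VectorField.lieBracket ℝ (e.vec j) (e.vec k) x) (e.vec i x)
    + g.inner x (VectorField.lieBracket ℝ (e.vec k) (e.vec i) x) (e.vec j x))

/-! ### Clifford multiplication -/

/-- Skew-Hermitian Clifford matrices: `γ_i γ_j + γ_j γ_i = -2 δ_ij`. -/
def gamma : Fin 4 → Matrix (Fin 4) (Fin 4) ℂ :=
  ![!![0, 0, -1, 0; 0, 0, 0, -1; 1, 0, 0, 0; 0, 1, 0, 0],
    !![0, 0, 0, Complex.I; 0, 0, Complex.I, 0; 0, Complex.I, 0, 0; Complex.I, 0, 0, 0],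
    !![0, 0, 0, 1; 0, 0, -1, 0; 0, 1, 0, 0; -1, 0, 0, 0],
    !![0, 0, Complex.I, 0; 0, 0, 0, -Complex.I; Complex.I, 0, 0, 0; 0, -Complex.I, 0, 0]]

theorem gamma_clifford (i j : Fin 4) :
    gamma i * gamma j + gamma j * gamma i = (if i = j then -2 else 0 : ℂ) • 1 := by
  have h0 : (0 : Matrix (Fin 4) (Fin 4) ℂ) =
      !![0, 0, 0, 0; 0, 0, 0, 0; 0, 0, 0, 0; 0, 0, 0, 0] := by
    ext k l; fin_cases k <;> fin_cases l <;> rfl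
  have h1 : (1 : Matrix (Fin 4) (Fin 4) ℂ) =
      !![1, 0, 0, 0; 0, 1, 0, 0; 0, 0, 1, 0; 0, 0, 0, 1] := by
    ext k l; fin_cases k <;> fin_cases l <;> simp
  fin_cases i <;> fin_cases j <;> simp [gamma, h0, h1] <;> norm_num

theorem gamma_skew (i : Fin 4) : (gamma i)ᴴ = -gamma i := by
  fin_cases i <;> ext k l <;> fin_cases k <;> fin_cases l <;> simp [gamma]

/-- Clifford multiplication by the `i`-th frame vector. -/
def cliff (i : Fin 4) : Spinor →L[ℂ] Spinor := Matrix.toEuclideanCLM (𝕜 := ℂ) (gamma i)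

/-- The chirality operator `γ₀γ₁γ₂γ₃`, an involution whose `±1`-eigenspaces are the two
half-spinor spaces. -/
def chirality : Spinor →L[ℂ] Spinor :=
  cliff 0 ∘L cliff 1 ∘L cliff 2 ∘L cliff 3

/-! ### The Dirac operator

Since `ℝ⁴` is contractible, its spin structure is unique, and a global orthonormal frame
trivializes the spinor bundle. -/

/-- The spin connection
`∇_{e_i} φ = ∂_{e_i} φ + ¼ ∑_{j,k} g(∇_{e_i} e_j, e_k) c(e_j) c(e_k) φ`. -/
def OrthonormalFrame.spinConnection {g : RiemannianMetric} (e : OrthonormalFrame g)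
    (i : Fin 4) (φ : E4 → Spinor) (x : E4) : Spinor :=
  fderiv ℝ φ x (e.vec i x) +
    (1 / 4 : ℂ) • ∑ j, ∑ k, (e.christoffel i j k x : ℂ) • cliff j (cliff k (φ x))

/-- The Dirac operator `D φ = ∑ᵢ c(e_i) ∇_{e_i} φ`. -/
def OrthonormalFrame.dirac {g : RiemannianMetric} (e : OrthonormalFrame g)
    (φ : E4 → Spinor) (x : E4) : Spinor :=
  ∑ i, cliff i (e.spinConnection i φ x)

/-- `D ψ = 0` in the sense of distributions (the Dirac operator is formally self-adjoint for
the Riemannian volume). -/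
def OrthonormalFrame.IsWeakSolution {g : RiemannianMetric} (e : OrthonormalFrame g)
    (ψ : E4 → Spinor) : Prop :=
  ∀ φ : E4 → Spinor, ContDiff ℝ ∞ φ → HasCompactSupport φ →
    ∫ x, inner ℂ (e.dirac φ x) (ψ x) ∂g.vol = 0

theorem RiemannianMetric.continuous_inner (g : RiemannianMetric) {u v : E4 → E4}
    (hu : Continuous u) (hv : Continuous v) : Continuous fun x => g.inner x (u x) (v x) := by
  have h := fun i j => (g.smooth i j).continuous
  unfold RiemannianMetric.inner
  fun_prop

instance RiemannianMetric.isLocallyFiniteMeasure_vol (g : RiemannianMetric) :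
    IsLocallyFiniteMeasure g.vol := by
  have h := fun i j => (g.smooth i j).continuous
  have hG : Continuous g.toMatrix := continuous_matrix h
  unfold RiemannianMetric.vol
  exact IsLocallyFiniteMeasure.withDensity_ofReal (by fun_prop)

theorem OrthonormalFrame.continuous_christoffel {g : RiemannianMetric} (e : OrthonormalFrame g)
    (i j k : Fin 4) : Continuous (e.christoffel i j k) := by
  have hb : ∀ i j, Continuous (VectorField.lieBracket ℝ (e.vec i) (e.vec j)) := fun i j =>
    (ContDiff.lieBracket_vectorField (m := 0) (e.smooth i) (e.smooth j) (by simp)).continuous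
  have hv := fun i => (e.smooth i).continuous
  unfold OrthonormalFrame.christoffel
  exact continuous_const.mul
    (((g.continuous_inner (hb _ _) (hv _)).sub (g.continuous_inner (hb _ _) (hv _))).add
      (g.continuous_inner (hb _ _) (hv _)))

theorem OrthonormalFrame.memLp_dirac {g : RiemannianMetric} (e : OrthonormalFrame g)
    {φ : E4 → Spinor} (hφ : ContDiff ℝ ∞ φ) (hc : HasCompactSupport φ) :
    MemLp (e.dirac φ) 2 g.vol := by
  refine Continuous.memLp_of_hasCompactSupport ?_ ?_
  · have h1 := fun i j k => Complex.continuous_ofReal.comp (e.continuous_christoffel i j k)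
    have h2 := hφ.continuous
    have h3 : ∀ i, Continuous fun x => fderiv ℝ φ x (e.vec i x) := fun i =>
      (hφ.continuous_fderiv (by simp)).clm_apply (e.smooth i).continuous
    unfold OrthonormalFrame.dirac OrthonormalFrame.spinConnection
    have h4 : ∀ i j k, Continuous fun x => (e.christoffel i j k x : ℂ) := h1
    fun_prop
  · refine HasCompactSupport.of_support_subset_isCompact hc.isCompact fun x hx => ?_
    by_contra hxs
    apply hx
    have h0 : φ x = 0 := image_eq_zero_of_notMem_tsupport hxs
    have h1 : fderiv ℝ φ x = 0 := by
      by_contra hne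
      exact hxs (support_fderiv_subset ℝ hne)
    simp [OrthonormalFrame.dirac, OrthonormalFrame.spinConnection, h0, h1]

/-! ### The `L²`-kernel and the `L²`-index -/

theorem integrable_inner {g : RiemannianMetric} {φ : E4 → Spinor} (hφ : MemLp φ 2 g.vol)
    (ψ : Lp Spinor 2 g.vol) : Integrable (fun x => inner ℂ (φ x) (ψ x)) g.vol := by
  refine (L2.integrable_inner (𝕜 := ℂ) (hφ.toLp φ) ψ).congr ?_
  filter_upwards [hφ.coeFn_toLp] with x hx
  rw [hx]

/-- The space of square-integrable solutions of `D ψ = 0` (in the sense of distributions). -/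
def OrthonormalFrame.l2Kernel {g : RiemannianMetric} (e : OrthonormalFrame g) :
    Submodule ℂ (Lp Spinor 2 g.vol) where
  carrier := {ψ | e.IsWeakSolution ψ}
  zero_mem' := by
    intro φ _ _
    refine integral_eq_zero_of_ae ?_
    filter_upwards [Lp.coeFn_zero Spinor 2 g.vol] with x hx
    rw [hx]
    exact inner_zero_right _
  add_mem' := by
    intro ψ₁ ψ₂ h₁ h₂ φ hφ hc
    have hD := e.memLp_dirac hφ hc
    have key : ∫ x, inner ℂ (e.dirac φ x) ((ψ₁ + ψ₂ : Lp Spinor 2 g.vol) x) ∂g.vol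
        = ∫ x, (inner ℂ (e.dirac φ x) (ψ₁ x) + inner ℂ (e.dirac φ x) (ψ₂ x)) ∂g.vol := by
      refine integral_congr_ae ?_
      filter_upwards [Lp.coeFn_add ψ₁ ψ₂] with x hx
      rw [hx]
      exact inner_add_right _ _ _
    rw [key, integral_add (integrable_inner hD ψ₁) (integrable_inner hD ψ₂), h₁ φ hφ hc,
      h₂ φ hφ hc, add_zero]
  smul_mem' := by
    intro c ψ h φ hφ hc
    have key : ∫ x, inner ℂ (e.dirac φ x) ((c • ψ : Lp Spinor 2 g.vol) x) ∂g.vol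
        = ∫ x, c * inner ℂ (e.dirac φ x) (ψ x) ∂g.vol := by
      refine integral_congr_ae ?_
      filter_upwards [Lp.coeFn_smul c ψ] with x hx
      rw [hx]
      exact inner_smul_right _ _ _
    rw [key, integral_const_mul, h φ hφ hc, mul_zero]

/-- The `L²`-sections of the half-spinor bundle on which the chirality operator is `s = ±1`. -/
def halfSpinors (g : RiemannianMetric) (s : ℂ) : Submodule ℂ (Lp Spinor 2 g.vol) where
  carrier := {ψ | ∀ᵐ x ∂g.vol, chirality (ψ x) = s • ψ x}
  zero_mem' := by
    filter_upwards [Lp.coeFn_zero Spinor 2 g.vol] with x hx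
    simp only [hx, Pi.zero_apply, map_zero, smul_zero]
  add_mem' := by
    intro ψ₁ ψ₂ h₁ h₂
    filter_upwards [h₁, h₂, Lp.coeFn_add ψ₁ ψ₂] with x h₁ h₂ hx
    simp only [hx, Pi.add_apply, map_add, smul_add, h₁, h₂]
  smul_mem' := by
    intro c ψ h
    filter_upwards [h, Lp.coeFn_smul c ψ] with x h hx
    simp only [hx, Pi.smul_apply, map_smul, h, smul_comm c s]

/-- The `L²`-kernel of the chiral part `D⁺` (`s = 1`) or `D⁻` (`s = -1`) of the Dirac operator. -/
def OrthonormalFrame.chiralKernel {g : RiemannianMetric} (e : OrthonormalFrame g) (s : ℂ) :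
    Submodule ℂ (Lp Spinor 2 g.vol) :=
  e.l2Kernel ⊓ halfSpinors g s

/-- The `L²`-index `dim ker D⁺ - dim ker D⁻` (meaningful when both kernels have finite
dimension). -/
def OrthonormalFrame.l2Index {g : RiemannianMetric} (e : OrthonormalFrame g) : ℤ :=
  (Module.finrank ℂ (e.chiralKernel 1) : ℤ) - (Module.finrank ℂ (e.chiralKernel (-1)) : ℤ)

/-! ### The Taub-NUT metric -/

/-- The vector field generating the Hopf circle action `(z₁, z₂) ↦ (e^{it} z₁, e^{it} z₂)`
on `ℝ⁴ = ℂ²`. -/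
def hopf (x : E4) : E4 := !₂[-x 1, x 0, -x 3, x 2]

/-- The matrix, in the Cartesian coordinates of `ℝ⁴`, of the metric which in the coordinates
`r = |x|²` and the Euler angles `(θ, φ, χ)` of `S³` is
`f(r)(dr² + r² dθ² + r² sin² θ dφ²) + g(r)(dχ + cos θ dφ)²`, where `f(r) = (a + b r) / r` and
`g(r) = (a r + b r²) / (1 + c r + d r²)`; see `polar_form`. -/
def kepler (a b c d : ℝ) (x : E4) : Matrix (Fin 4) (Fin 4) ℝ := fun i j =>
  4 * (a + b * ‖x‖ ^ 2) * ((if i = j then 1 else 0)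
    - (c + d * ‖x‖ ^ 2) / (1 + c * ‖x‖ ^ 2 + d * (‖x‖ ^ 2) ^ 2) * hopf x i * hopf x j)

/-- Euler coordinates on `ℝ⁴ = ℂ²`:
`z₁ = √r cos(θ/2) e^{i(χ+φ)/2}`, `z₂ = √r sin(θ/2) e^{i(χ-φ)/2}`. -/
def euler (r θ φ χ : ℝ) : E4 :=
  !₂[√r * Real.cos (θ / 2) * Real.cos ((χ + φ) / 2),
    √r * Real.cos (θ / 2) * Real.sin ((χ + φ) / 2),
    √r * Real.sin (θ / 2) * Real.cos ((χ - φ) / 2),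
    √r * Real.sin (θ / 2) * Real.sin ((χ - φ) / 2)]

theorem norm_sq_eq (x : E4) : ‖x‖ ^ 2 = x 0 ^ 2 + x 1 ^ 2 + x 2 ^ 2 + x 3 ^ 2 := by
  rw [EuclideanSpace.real_norm_sq_eq, Fin.sum_univ_four]

theorem kepler_form (a b c d : ℝ) (x u v : E4) :
    ∑ i, ∑ j, kepler a b c d x i j * u i * v j =
      4 * (a + b * ‖x‖ ^ 2) * ((u 0 * v 0 + u 1 * v 1 + u 2 * v 2 + u 3 * v 3)
        - (c + d * ‖x‖ ^ 2) / (1 + c * ‖x‖ ^ 2 + d * (‖x‖ ^ 2) ^ 2)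
          * (-x 1 * u 0 + x 0 * u 1 - x 3 * u 2 + x 2 * u 3)
          * (-x 1 * v 0 + x 0 * v 1 - x 3 * v 2 + x 2 * v 3)) := by
  simp [Fin.sum_univ_four, kepler, hopf]
  ring

theorem sum_sq_aux {c s C S K L : ℝ} (p q h α β : ℝ) (e1 : s ^ 2 + c ^ 2 = 1)
    (e2 : S ^ 2 + C ^ 2 = 1) (e3 : L ^ 2 + K ^ 2 = 1) :
    ((p * c + q * (-s * h)) * C + q * c * (-S * α)) * ((p * c + q * (-s * h)) * C + q * c * (-S * α))
      + ((p * c + q * (-s * h)) * S + q * c * (C * α)) * ((p * c + q * (-s * h)) * S + q * c * (C * α))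
      + ((p * s + q * (c * h)) * K + q * s * (-L * β)) * ((p * s + q * (c * h)) * K + q * s * (-L * β))
      + ((p * s + q * (c * h)) * L + q * s * (K * β)) * ((p * s + q * (c * h)) * L + q * s * (K * β))
      = p ^ 2 + q ^ 2 * (h ^ 2 + c ^ 2 * α ^ 2 + s ^ 2 * β ^ 2) := by
  linear_combination ((p * c - q * s * h) ^ 2 + q ^ 2 * c ^ 2 * α ^ 2) * e2
    + ((p * s + q * c * h) ^ 2 + q ^ 2 * s ^ 2 * β ^ 2) * e3 + (p ^ 2 + q ^ 2 * h ^ 2) * e1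

theorem hopf_form_aux {c s C S K L : ℝ} (p q h α β : ℝ)
    (e2 : S ^ 2 + C ^ 2 = 1) (e3 : L ^ 2 + K ^ 2 = 1) :
    -(q * c * S) * ((p * c + q * (-s * h)) * C + q * c * (-S * α))
      + q * c * C * ((p * c + q * (-s * h)) * S + q * c * (C * α))
      - q * s * L * ((p * s + q * (c * h)) * K + q * s * (-L * β))
      + q * s * K * ((p * s + q * (c * h)) * L + q * s * (K * β))
      = q ^ 2 * (c ^ 2 * α + s ^ 2 * β) := by
  linear_combination q ^ 2 * c ^ 2 * α * e2 + q ^ 2 * s ^ 2 * β * e3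

theorem hasDerivAt_vec {f₀ f₁ f₂ f₃ : ℝ → ℝ} {d₀ d₁ d₂ d₃ t : ℝ} (h₀ : HasDerivAt f₀ d₀ t)
    (h₁ : HasDerivAt f₁ d₁ t) (h₂ : HasDerivAt f₂ d₂ t) (h₃ : HasDerivAt f₃ d₃ t) :
    HasDerivAt (fun s => (!₂[f₀ s, f₁ s, f₂ s, f₃ s] : E4)) !₂[d₀, d₁, d₂, d₃] t := by
  have h : HasDerivAt (fun s => ![f₀ s, f₁ s, f₂ s, f₃ s]) ![d₀, d₁, d₂, d₃] t := by
    refine hasDerivAt_pi.2 fun i => ?_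
    fin_cases i
    exacts [h₀, h₁, h₂, h₃]
  exact (PiLp.continuousLinearEquiv 2 ℝ (fun _ : Fin 4 => ℝ)).symm.hasFDerivAt.comp_hasDerivAt t h

/-- The line element of the metric `kepler a b c d` in Euler coordinates, along any curve. -/
theorem polar_form (a b c d : ℝ) {r θ φ χ : ℝ → ℝ} {r' θ' φ' χ' t : ℝ}
    (hr : HasDerivAt r r' t) (hθ : HasDerivAt θ θ' t) (hφ : HasDerivAt φ φ' t)
    (hχ : HasDerivAt χ χ' t) (hpos : 0 < r t) (hden : 1 + c * r t + d * r t ^ 2 ≠ 0) :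
    ∃ v : E4, HasDerivAt (fun s => euler (r s) (θ s) (φ s) (χ s)) v t ∧
      ∑ i, ∑ j, kepler a b c d (euler (r t) (θ t) (φ t) (χ t)) i j * v i * v j =
        (a + b * r t) / r t *
            (r' ^ 2 + r t ^ 2 * θ' ^ 2 + r t ^ 2 * Real.sin (θ t) ^ 2 * φ' ^ 2)
          + (a * r t + b * r t ^ 2) / (1 + c * r t + d * r t ^ 2)
            * (χ' + Real.cos (θ t) * φ') ^ 2 := by
  have hq := hr.sqrt hpos.ne'
  have hc := (hθ.div_const 2).cos
  have hs := (hθ.div_const 2).sin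
  have hcA := ((hχ.add hφ).div_const 2).cos
  have hsA := ((hχ.add hφ).div_const 2).sin
  have hcB := ((hχ.sub hφ).div_const 2).cos
  have hsB := ((hχ.sub hφ).div_const 2).sin
  have h0 := (hq.mul hc).mul hcA
  have h1 := (hq.mul hc).mul hsA
  have h2 := (hq.mul hs).mul hcB
  have h3 := (hq.mul hs).mul hsB
  refine ⟨_, hasDerivAt_vec h0 h1 h2 h3, ?_⟩
  · rw [kepler_form, norm_sq_eq]
    have hqq : √(r t) ^ 2 = r t := Real.sq_sqrt hpos.le
    have hq0 : √(r t) ≠ 0 := (Real.sqrt_pos.2 hpos).ne'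
    have e1 := Real.sin_sq_add_cos_sq (θ t / 2)
    have e2 := Real.sin_sq_add_cos_sq ((χ t + φ t) / 2)
    have e3 := Real.sin_sq_add_cos_sq ((χ t - φ t) / 2)
    have e4 : Real.cos (θ t) = Real.cos (θ t / 2) ^ 2 - Real.sin (θ t / 2) ^ 2 := by
      rw [← Real.cos_two_mul']; ring_nf
    have e5 : Real.sin (θ t) = 2 * Real.sin (θ t / 2) * Real.cos (θ t / 2) := by
      rw [← Real.sin_two_mul]; ring_nf
    have hN : (√(r t) * Real.cos (θ t / 2) * Real.cos ((χ t + φ t) / 2)) ^ 2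
        + (√(r t) * Real.cos (θ t / 2) * Real.sin ((χ t + φ t) / 2)) ^ 2
        + (√(r t) * Real.sin (θ t / 2) * Real.cos ((χ t - φ t) / 2)) ^ 2
        + (√(r t) * Real.sin (θ t / 2) * Real.sin ((χ t - φ t) / 2)) ^ 2 = r t := by
      linear_combination √(r t) ^ 2 * Real.cos (θ t / 2) ^ 2 * e2
        + √(r t) ^ 2 * Real.sin (θ t / 2) ^ 2 * e3 + √(r t) ^ 2 * e1 + hqq
    have hp : (r' / (2 * √(r t))) ^ 2 = r' ^ 2 / (4 * r t) := by
      rw [div_pow, mul_pow, hqq]; norm_num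
    have hS := sum_sq_aux (r' / (2 * √(r t))) (√(r t)) (θ' / 2) ((χ' + φ') / 2) ((χ' - φ') / 2)
      e1 e2 e3
    have hW := hopf_form_aux (c := Real.cos (θ t / 2)) (s := Real.sin (θ t / 2))
      (r' / (2 * √(r t))) (√(r t)) (θ' / 2) ((χ' + φ') / 2) ((χ' - φ') / 2) e2 e3
    rw [hqq] at hS hW
    rw [hp] at hS
    change 4 * (a + b * ((√(r t) * Real.cos (θ t / 2) * Real.cos ((χ t + φ t) / 2)) ^ 2
        + (√(r t) * Real.cos (θ t / 2) * Real.sin ((χ t + φ t) / 2)) ^ 2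
        + (√(r t) * Real.sin (θ t / 2) * Real.cos ((χ t - φ t) / 2)) ^ 2
        + (√(r t) * Real.sin (θ t / 2) * Real.sin ((χ t - φ t) / 2)) ^ 2)) * (_ - (c + d *
        ((√(r t) * Real.cos (θ t / 2) * Real.cos ((χ t + φ t) / 2)) ^ 2
        + (√(r t) * Real.cos (θ t / 2) * Real.sin ((χ t + φ t) / 2)) ^ 2
        + (√(r t) * Real.sin (θ t / 2) * Real.cos ((χ t - φ t) / 2)) ^ 2
        + (√(r t) * Real.sin (θ t / 2) * Real.sin ((χ t - φ t) / 2)) ^ 2)) / (1 + c *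
        ((√(r t) * Real.cos (θ t / 2) * Real.cos ((χ t + φ t) / 2)) ^ 2
        + (√(r t) * Real.cos (θ t / 2) * Real.sin ((χ t + φ t) / 2)) ^ 2
        + (√(r t) * Real.sin (θ t / 2) * Real.cos ((χ t - φ t) / 2)) ^ 2
        + (√(r t) * Real.sin (θ t / 2) * Real.sin ((χ t - φ t) / 2)) ^ 2) + d *
        ((√(r t) * Real.cos (θ t / 2) * Real.cos ((χ t + φ t) / 2)) ^ 2
        + (√(r t) * Real.cos (θ t / 2) * Real.sin ((χ t + φ t) / 2)) ^ 2
        + (√(r t) * Real.sin (θ t / 2) * Real.cos ((χ t - φ t) / 2)) ^ 2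
        + (√(r t) * Real.sin (θ t / 2) * Real.sin ((χ t - φ t) / 2)) ^ 2) ^ 2) * _ * _) = _
    rw [hN]
    refine (congrArg₂ (fun A B => 4 * (a + b * r t) * (A - (c + d * r t) /
      (1 + c * r t + d * r t ^ 2) * B * B)) hS hW).trans ?_
    have e6 : Real.sin (θ t / 2) ^ 2 = 1 - Real.cos (θ t / 2) ^ 2 := by linarith
    have e7 : c + d * r t = (1 + c * r t + d * r t ^ 2 - 1) / r t := by
      field_simp
      ring
    rw [e4, e5, mul_pow, mul_pow, e6, e7]
    generalize 1 + c * r t + d * r t ^ 2 = X at hden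
    field_simp
    ring

theorem kepler_den {a b : ℝ} (ha : 0 < a) (r : ℝ) :
    1 + 2 * b / a * r + b ^ 2 / a ^ 2 * r ^ 2 = ((a + b * r) / a) ^ 2 := by
  field_simp
  ring

theorem hopf_smooth : ContDiff ℝ ∞ hopf := by
  rw [contDiff_euclidean]
  intro i
  fin_cases i <;> simp [hopf] <;> fun_prop

/-- The standard Euclidean Taub-NUT metric with parameters `a, b > 0`: the case `c = 2 b / a`,
`d = b² / a²`. -/
def taubNUT (a b : ℝ) (ha : 0 < a) (hb : 0 < b) : RiemannianMetric where
  toMatrix := kepler a b (2 * b / a) (b ^ 2 / a ^ 2)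
  smooth i j := by
    have h := contDiff_euclidean.1 hopf_smooth
    have h0 : ContDiff ℝ ∞ fun x : E4 => ‖x‖ ^ 2 := contDiff_norm_sq ℝ
    have h1 : ∀ x : E4,
        1 + 2 * b / a * ‖x‖ ^ 2 + b ^ 2 / a ^ 2 * (‖x‖ ^ 2) ^ 2 ≠ 0 := fun x => by positivity
    unfold kepler
    refine (contDiff_const.mul (contDiff_const.add (contDiff_const.mul h0))).mul
      (contDiff_const.sub ((ContDiff.mul (ContDiff.div ?_ ?_ h1) (h i)).mul (h j)))
    · exact contDiff_const.add (contDiff_const.mul h0)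
    · exact (contDiff_const.add (contDiff_const.mul h0)).add (contDiff_const.mul (h0.pow 2))
  symm x i j := by
    simp only [kepler, eq_comm (a := i) (b := j)]
    ring
  pos x v hv := by
    rw [kepler_form]
    have hr : 0 ≤ ‖x‖ ^ 2 := by positivity
    have hv2 : 0 < ‖v‖ ^ 2 := by positivity
    rw [norm_sq_eq] at hv2
    have hx := norm_sq_eq x
    generalize ‖x‖ ^ 2 = r at hr hx
    have hk : (2 * b / a + b ^ 2 / a ^ 2 * r) / (1 + 2 * b / a * r + b ^ 2 / a ^ 2 * r ^ 2) * r
        < 1 := by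
      rw [div_mul_eq_mul_div, div_lt_one (by positivity)]
      nlinarith
    have hk0 : 0 ≤ (2 * b / a + b ^ 2 / a ^ 2 * r) / (1 + 2 * b / a * r + b ^ 2 / a ^ 2 * r ^ 2) := by
      positivity
    generalize (2 * b / a + b ^ 2 / a ^ 2 * r) / (1 + 2 * b / a * r + b ^ 2 / a ^ 2 * r ^ 2) = k
      at hk hk0
    have hcs : (-x 1 * v 0 + x 0 * v 1 - x 3 * v 2 + x 2 * v 3) ^ 2
        ≤ r * (v 0 ^ 2 + v 1 ^ 2 + v 2 ^ 2 + v 3 ^ 2) := by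
      rw [hx]
      nlinarith [sq_nonneg (x 0 * v 0 + x 1 * v 1), sq_nonneg (x 2 * v 2 + x 3 * v 3),
        sq_nonneg (x 0 * v 2 + x 3 * v 1), sq_nonneg (x 1 * v 2 - x 3 * v 0),
        sq_nonneg (x 0 * v 3 - x 2 * v 1), sq_nonneg (x 1 * v 3 + x 2 * v 0)]
    have hfac : 0 < 4 * (a + b * r) := by positivity
    refine mul_pos hfac ?_
    nlinarith [mul_le_mul_of_nonneg_left hcs hk0]

theorem frame_dot (l k : ℝ) (x : E4) (i j : Fin 4) :
    (l • (EuclideanSpace.single i 1 + (k * hopf x i) • hopf x) : E4) 0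
        * (l • (EuclideanSpace.single j 1 + (k * hopf x j) • hopf x) : E4) 0
      + (l • (EuclideanSpace.single i 1 + (k * hopf x i) • hopf x) : E4) 1
        * (l • (EuclideanSpace.single j 1 + (k * hopf x j) • hopf x) : E4) 1
      + (l • (EuclideanSpace.single i 1 + (k * hopf x i) • hopf x) : E4) 2
        * (l • (EuclideanSpace.single j 1 + (k * hopf x j) • hopf x) : E4) 2
      + (l • (EuclideanSpace.single i 1 + (k * hopf x i) • hopf x) : E4) 3
        * (l • (EuclideanSpace.single j 1 + (k * hopf x j) • hopf x) : E4) 3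
      = l ^ 2 * ((if i = j then 1 else 0)
        + (2 * k + k ^ 2 * ‖x‖ ^ 2) * (hopf x i * hopf x j)) := by
  rw [norm_sq_eq]
  fin_cases i <;> fin_cases j <;> simp [hopf] <;> ring

theorem frame_hopf (l k : ℝ) (x : E4) (i : Fin 4) :
    -x 1 * (l • (EuclideanSpace.single i 1 + (k * hopf x i) • hopf x) : E4) 0
      + x 0 * (l • (EuclideanSpace.single i 1 + (k * hopf x i) • hopf x) : E4) 1
      - x 3 * (l • (EuclideanSpace.single i 1 + (k * hopf x i) • hopf x) : E4) 2
      + x 2 * (l • (EuclideanSpace.single i 1 + (k * hopf x i) • hopf x) : E4) 3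
      = l * (1 + k * ‖x‖ ^ 2) * hopf x i := by
  rw [norm_sq_eq]
  fin_cases i <;> simp [hopf] <;> ring

/-- The orthonormal frame of the Taub-NUT metric `g` obtained by applying the positive square
root `g^{-1/2}` to the standard coordinate frame of `ℝ⁴`. -/
def taubNUTFrame (a b : ℝ) (ha : 0 < a) (hb : 0 < b) : OrthonormalFrame (taubNUT a b ha hb) where
  vec i x := (1 / (2 * √(a + b * ‖x‖ ^ 2))) •
    (EuclideanSpace.single i 1 + (b / a * hopf x i) • hopf x)
  smooth i := by
    have h0 : ContDiff ℝ ∞ fun x : E4 => ‖x‖ ^ 2 := contDiff_norm_sq ℝ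
    have h1 : ContDiff ℝ ∞ fun x : E4 => √(a + b * ‖x‖ ^ 2) :=
      (contDiff_const.add (contDiff_const.mul h0)).sqrt fun x => by positivity
    refine (contDiff_const.div (contDiff_const.mul h1) fun x => by positivity).smul
      (contDiff_const.add ((contDiff_const.mul (contDiff_euclidean.1 hopf_smooth i)).smul
        hopf_smooth))
  orthonormal x i j := by
    have hr : 0 ≤ ‖x‖ ^ 2 := by positivity
    have hx := norm_sq_eq x
    have hp : 0 < a + b * ‖x‖ ^ 2 := by positivity
    have hs : √(a + b * ‖x‖ ^ 2) ^ 2 = a + b * ‖x‖ ^ 2 := Real.sq_sqrt hp.le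
    have hs0 : √(a + b * ‖x‖ ^ 2) ≠ 0 := (Real.sqrt_pos.2 hp).ne'
    have ha0 := ha.ne'
    rw [RiemannianMetric.inner, show (taubNUT a b ha hb).toMatrix = kepler a b (2 * b / a)
      (b ^ 2 / a ^ 2) from rfl, kepler_form, frame_dot, frame_hopf, frame_hopf, kepler_den ha]
    generalize √(a + b * ‖x‖ ^ 2) = q at hs hs0 ⊢
    generalize ‖x‖ ^ 2 = ρ at *
    generalize hopf x i = u
    generalize hopf x j = v
    have hp0 := hp.ne'
    have key : (2 * b / a + b ^ 2 / a ^ 2 * ρ) / ((a + b * ρ) / a) ^ 2 * (1 + b / a * ρ) ^ 2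
        = 2 * (b / a) + (b / a) ^ 2 * ρ := by
      field_simp
    have hl : 4 * (a + b * ρ) * (1 / (2 * q)) ^ 2 = 1 := by
      rw [← hs]
      field_simp
      norm_num
    linear_combination (if i = j then 1 else 0) * hl
      - 4 * (a + b * ρ) * (1 / (2 * q)) ^ 2 * u * v * key

end TaubNUT

end

/-!
Put `κ = b / a` and let `h` be the Hopf field. The Taub-NUT frame is the function `frameScale` times
the flat frame `wᵢ = ∂ᵢ + κ hᵢ h`, so `D = frameScale • D₀` with `D₀ = ∑ cᵢ ∂_{wᵢ}` up to a
zeroth-order term. An `L²` solution `ψ` of `D ψ = 0` solves `D₀ ψ = 0` weakly, and it is square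
integrable for Lebesgue measure, because the Taub-NUT volume density is bounded below.

For compactly supported smooth `φ`, Lichnerowicz's integration by parts gives
`∫ ∑ ‖∇ᵢ φ‖² = ∫ ‖D₀ φ‖²` for a suitable metric connection `∇ᵢ = ∂_{wᵢ} + ωᵢ`, all the other terms
adding up to a divergence. Since `∑ xᵢ wᵢ = x` and `∑ xᵢ ωᵢ = 0`, the radial derivative of `φ` is
`∑ xᵢ ∇ᵢ φ`, and Hardy's inequality along rays yields `∫ ‖φ‖² / (1 + |x|²) ≤ ∫ ‖D₀ φ‖²`.

By Friedrichs mollification this inequality extends to compactly supported `L²` functions with weak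
`D₀` in `L²`, in particular to `χ_R ψ` with a radial cutoff `χ_R`. As `⟪x, wᵢ⟫ = xᵢ`, the
commutator `[D₀, χ_R]` is `O(1 / R)` even though `wᵢ` grows quadratically; let `R → ∞`.
-/

noncomputable section

namespace TaubNUT

/-! ### Divergences -/

section Divergence

variable {E : Type*} [NormedAddCommGroup E] [NormedSpace ℝ E]

/-- The divergence of a vector field on a real normed space: the trace of its derivative. -/
def divergence (w : E → E) (x : E) : ℝ := LinearMap.trace ℝ E (fderiv ℝ w x)

/-- The functions which are the divergence of a compactly supported `C¹` vector field; they have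
integral zero for every Haar measure. -/
def IsTotalDivergence (f : E → ℝ) : Prop :=
  ∃ w : E → E, ContDiff ℝ 1 w ∧ HasCompactSupport w ∧ divergence w = f

theorem divergence_add {v w : E → E} {x : E} (hv : DifferentiableAt ℝ v x)
    (hw : DifferentiableAt ℝ w x) :
    divergence (fun y => v y + w y) x = divergence v x + divergence w x := by
  rw [divergence, fderiv_fun_add hv hw, ContinuousLinearMap.toLinearMap_add, map_add]
  rfl

theorem divergence_sub {v w : E → E} {x : E} (hv : DifferentiableAt ℝ v x)
    (hw : DifferentiableAt ℝ w x) :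
    divergence (fun y => v y - w y) x = divergence v x - divergence w x := by
  rw [divergence, fderiv_fun_sub hv hw, ContinuousLinearMap.toLinearMap_sub, map_sub]
  rfl

theorem divergence_const_smul (c : ℝ) {w : E → E} {x : E} (hw : DifferentiableAt ℝ w x) :
    divergence (fun y => c • w y) x = c * divergence w x := by
  rw [divergence, fderiv_fun_const_smul hw, ContinuousLinearMap.toLinearMap_smul, map_smul,
    smul_eq_mul]
  rfl

theorem divergence_sum {ι : Type*} (s : Finset ι) {w : ι → E → E} {x : E}
    (hw : ∀ i ∈ s, DifferentiableAt ℝ (w i) x) :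
    divergence (fun y => ∑ i ∈ s, w i y) x = ∑ i ∈ s, divergence (w i) x := by
  rw [divergence, fderiv_fun_sum hw, ContinuousLinearMap.toLinearMap_sum, map_sum]
  rfl

theorem IsTotalDivergence.add {f g : E → ℝ} (hf : IsTotalDivergence f)
    (hg : IsTotalDivergence g) : IsTotalDivergence fun x => f x + g x := by
  obtain ⟨v, hv, hvc, rfl⟩ := hf
  obtain ⟨w, hw, hwc, rfl⟩ := hg
  exact ⟨_, hv.add hw, hvc.add hwc, funext fun x =>
    divergence_add (hv.differentiable one_ne_zero x) (hw.differentiable one_ne_zero x)⟩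

theorem IsTotalDivergence.const_mul {f : E → ℝ} (c : ℝ) (hf : IsTotalDivergence f) :
    IsTotalDivergence fun x => c * f x := by
  obtain ⟨w, hw, hwc, rfl⟩ := hf
  exact ⟨_, hw.const_smul c, hwc.smul_left (f := fun _ => c), funext fun x =>
    divergence_const_smul c (hw.differentiable one_ne_zero x)⟩

theorem isTotalDivergence_zero : IsTotalDivergence fun _ : E => 0 :=
  ⟨fun _ => 0, contDiff_const, HasCompactSupport.zero, funext fun x => by simp [divergence]⟩

theorem IsTotalDivergence.sum {ι : Type*} (s : Finset ι) {f : ι → E → ℝ}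
    (hf : ∀ i ∈ s, IsTotalDivergence (f i)) : IsTotalDivergence fun x => ∑ i ∈ s, f i x := by
  classical
  induction s using Finset.induction_on with
  | empty => simpa only [Finset.sum_empty] using isTotalDivergence_zero
  | insert i s hi ih =>
    simp only [Finset.sum_insert hi]
    exact (hf i (s.mem_insert_self i)).add (ih fun j hj => hf j (Finset.mem_insert_of_mem hj))

theorem hasCompactSupport_divergence {w : E → E} (hwc : HasCompactSupport w) :
    HasCompactSupport (divergence w) :=
  (hwc.fderiv ℝ).mono fun x hx h0 => hx (by simp [divergence, h0])

variable [FiniteDimensional ℝ E]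

theorem divergence_smul {F : E → ℝ} {w : E → E} {x : E} (hF : DifferentiableAt ℝ F x)
    (hw : DifferentiableAt ℝ w x) :
    divergence (fun y => F y • w y) x = fderiv ℝ F x (w x) + divergence w x * F x := by
  rw [divergence, fderiv_fun_smul hF hw, ContinuousLinearMap.toLinearMap_add, map_add,
    ContinuousLinearMap.toLinearMap_smul, map_smul, smul_eq_mul, add_comm, mul_comm, divergence]
  congr 1
  exact LinearMap.trace_smulRight _ _

theorem continuous_divergence {w : E → E} (hw : ContDiff ℝ 1 w) : Continuous (divergence w) :=
  ((LinearMap.trace ℝ E ∘ₗ ContinuousLinearMap.coeLM ℝ).continuous_of_finiteDimensional).comp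
    (hw.continuous_fderiv one_ne_zero)

section Integral

variable [MeasurableSpace E] [BorelSpace E] (μ : Measure E) [μ.IsAddHaarMeasure]

theorem integral_fderiv_apply_eq_zero {F : E → ℝ} (hF : ContDiff ℝ 1 F)
    (hFc : HasCompactSupport F) (v : E) : ∫ x, fderiv ℝ F x v ∂μ = 0 := by
  have hint : Integrable (fun x => fderiv ℝ F x v) μ :=
    ((hF.continuous_fderiv one_ne_zero).clm_apply continuous_const).integrable_of_hasCompactSupport
      (hFc.fderiv_apply (𝕜 := ℝ) v)
  simpa using integral_mul_fderiv_eq_neg_fderiv_mul_of_integrable (μ := μ) (v := v)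
    (f := fun _ => 1) (g := F) (by simp) (by simpa using hint)
    (by simpa using hF.continuous.integrable_of_hasCompactSupport hFc)
    (fun _ _ => differentiableAt_const 1) fun x _ => hF.differentiable one_ne_zero x

theorem integral_divergence {w : E → E} (hw : ContDiff ℝ 1 w) (hwc : HasCompactSupport w) :
    ∫ x, divergence w x ∂μ = 0 := by
  let b := Module.finBasis ℝ E
  let coord i : E →L[ℝ] ℝ := (b.coord i).toContinuousLinearMap
  have hcoord i : ContDiff ℝ 1 fun x => coord i (w x) := (coord i).contDiff.comp hw
  have hcoordc i : HasCompactSupport fun x => coord i (w x) := hwc.comp_left (map_zero (coord i))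
  have hsum : divergence w = fun x => ∑ i, fderiv ℝ (fun y => coord i (w y)) x (b i) := by
    funext x
    have hexp : w = fun y => ∑ i, coord i (w y) • b i := funext fun y => (b.sum_repr (w y)).symm
    conv_lhs => rw [hexp]
    rw [divergence_sum _ fun i _ => ((hcoord i).differentiable one_ne_zero x).smul_const (b i)]
    refine Finset.sum_congr rfl fun i _ => ?_
    rw [divergence_smul ((hcoord i).differentiable one_ne_zero x) (differentiableAt_const (b i))]
    simp [divergence]
  rw [hsum, integral_finsetSum _ fun i _ =>
    (((hcoord i).continuous_fderiv one_ne_zero).clm_apply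
      continuous_const).integrable_of_hasCompactSupport ((hcoordc i).fderiv_apply (𝕜 := ℝ) (b i))]
  exact Finset.sum_eq_zero fun i _ => integral_fderiv_apply_eq_zero μ (hcoord i) (hcoordc i) (b i)

theorem integral_fderiv_add_divergence_mul {F : E → ℝ} {w : E → E} (hF : ContDiff ℝ 1 F)
    (hFc : HasCompactSupport F) (hw : ContDiff ℝ 1 w) :
    ∫ x, (fderiv ℝ F x (w x) + divergence w x * F x) ∂μ = 0 := by
  rw [← integral_divergence μ (hF.smul hw) (hFc.smul_right (f' := w))]
  exact integral_congr_ae (.of_forall fun x => (divergence_smul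
    (hF.differentiable one_ne_zero x) (hw.differentiable one_ne_zero x)).symm)

theorem IsTotalDivergence.integral_eq_zero {f : E → ℝ} (hf : IsTotalDivergence f) :
    ∫ x, f x ∂μ = 0 := by
  obtain ⟨w, hw, hwc, rfl⟩ := hf
  exact integral_divergence μ hw hwc

theorem IsTotalDivergence.integrable {f : E → ℝ} (hf : IsTotalDivergence f) :
    Integrable f μ := by
  obtain ⟨w, hw, hwc, rfl⟩ := hf
  exact (continuous_divergence hw).integrable_of_hasCompactSupport
    (hasCompactSupport_divergence hwc)

end Integral

end Divergence

/-! ### Null forms and Hardy's inequality -/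

section NullForms

variable {E H : Type*} [NormedAddCommGroup E] [NormedSpace ℝ E] [NormedAddCommGroup H]
  [InnerProductSpace ℝ H] {φ : E → H} {V W : E → E}

/-- The divergence of the bivector field `V ∧ W`, in terms of the Lie bracket; it is what remains
when two derivatives `∂_V` and `∂_W` are exchanged under the integral sign. -/
def divBracket (V W : E → E) (x : E) : E :=
  VectorField.lieBracket ℝ V W x + divergence V x • W x - divergence W x • V x

theorem contDiff_fderiv_apply {m n : ℕ∞ω} (hmn : m + 1 ≤ n) {F : Type*}
    [NormedAddCommGroup F] [NormedSpace ℝ F] {φ : E → F} (hφ : ContDiff ℝ n φ)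
    (hV : ContDiff ℝ m V) : ContDiff ℝ m fun x => fderiv ℝ φ x (V x) :=
  (hφ.fderiv_right hmn).clm_apply hV

theorem fderiv_fderiv_apply (hφ : ContDiff ℝ 2 φ) (hW : ContDiff ℝ 1 W) (x v : E) :
    fderiv ℝ (fun y => fderiv ℝ φ y (W y)) x v =
      fderiv ℝ (fderiv ℝ φ) x v (W x) + fderiv ℝ φ x (fderiv ℝ W x v) := by
  have h1 : DifferentiableAt ℝ (fderiv ℝ φ) x :=
    (hφ.fderiv_right (m := 1) (by norm_num)).differentiable one_ne_zero x
  rw [fderiv_clm_apply h1 (hW.differentiable one_ne_zero x)]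
  simp [add_comm]

theorem fderiv_fderiv_comm (hφ : ContDiff ℝ 2 φ) (x u v : E) :
    fderiv ℝ (fderiv ℝ φ) x u v = fderiv ℝ (fderiv ℝ φ) x v u :=
  (hφ.contDiffAt.isSymmSndFDerivAt (by simp)).eq u v

theorem fderiv_inner_clm_fderiv {T : H →L[ℝ] H} (hφ : ContDiff ℝ 2 φ) (hW : ContDiff ℝ 1 W)
    (x v : E) : fderiv ℝ (fun y => inner ℝ (φ y) (T (fderiv ℝ φ y (W y)))) x v =
      inner ℝ (fderiv ℝ φ x v) (T (fderiv ℝ φ x (W x)))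
        + inner ℝ (φ x) (T (fderiv ℝ (fderiv ℝ φ) x v (W x)))
        + inner ℝ (φ x) (T (fderiv ℝ φ x (fderiv ℝ W x v))) := by
  have hT : HasFDerivAt (fun y => T (fderiv ℝ φ y (W y))) _ x :=
    T.hasFDerivAt.comp x ((contDiff_fderiv_apply (m := 1) (by norm_num) hφ hW).differentiable
      one_ne_zero x).hasFDerivAt
  rw [fderiv_inner_apply ℝ (hφ.differentiable two_ne_zero x) hT.differentiableAt, hT.fderiv]
  simp only [ContinuousLinearMap.comp_apply, fderiv_fderiv_apply hφ hW, map_add, inner_add_right]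
  ring

variable [FiniteDimensional ℝ E]

theorem isTotalDivergence_nullForm {T : H →L[ℝ] H} (hT : ∀ u v, inner ℝ (T u) v = -inner ℝ u (T v))
    (hφ : ContDiff ℝ 2 φ) (hφc : HasCompactSupport φ) (hV : ContDiff ℝ 1 V)
    (hW : ContDiff ℝ 1 W) :
    IsTotalDivergence fun x => 2 * inner ℝ (fderiv ℝ φ x (V x)) (T (fderiv ℝ φ x (W x)))
      + inner ℝ (φ x) (T (fderiv ℝ φ x (divBracket V W x))) := by
  let F (U : E → E) (x : E) : ℝ := inner ℝ (φ x) (T (fderiv ℝ φ x (U x)))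
  have hF {U : E → E} (hU : ContDiff ℝ 1 U) : ContDiff ℝ 1 (F U) :=
    (hφ.of_le (by norm_num)).inner ℝ
      (T.contDiff.comp (contDiff_fderiv_apply (by norm_num) hφ hU))
  have hFc (U : E → E) : HasCompactSupport (F U) :=
    hφc.mono fun x hx h0 => hx (by simp [F, h0])
  refine ⟨fun x => F W x • V x - F V x • W x, ((hF hW).smul hV).sub ((hF hV).smul hW),
    ((hFc W).smul_right (f' := V)).sub ((hFc V).smul_right (f' := W)), funext fun x => ?_⟩
  have hdiff {U U' : E → E} (hU : ContDiff ℝ 1 U) (hU' : ContDiff ℝ 1 U') :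
      DifferentiableAt ℝ (fun y => F U y • U' y) x :=
    ((hF hU).smul hU').differentiable one_ne_zero x
  have hskew := hT (fderiv ℝ φ x (W x)) (fderiv ℝ φ x (V x))
  rw [real_inner_comm] at hskew
  rw [divergence_sub (hdiff hW hV) (hdiff hV hW),
    divergence_smul ((hF hW).differentiable one_ne_zero x) (hV.differentiable one_ne_zero x),
    divergence_smul ((hF hV).differentiable one_ne_zero x) (hW.differentiable one_ne_zero x),
    fderiv_inner_clm_fderiv hφ hW, fderiv_inner_clm_fderiv hφ hV,
    fderiv_fderiv_comm hφ x (W x) (V x)]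
  simp only [divBracket, VectorField.lieBracket_eq, map_add, map_sub, map_smul, inner_add_right,
    inner_sub_right, real_inner_smul_right, F]
  linear_combination -hskew

theorem isTotalDivergence_radialForm {w : E → ℝ} (hw : ContDiff ℝ 1 w) (hφ : ContDiff ℝ 1 φ)
    (hφc : HasCompactSupport φ) :
    IsTotalDivergence fun x => 2 * w x * inner ℝ (φ x) (fderiv ℝ φ x x)
      + (Module.finrank ℝ E * w x + fderiv ℝ w x x) * ‖φ x‖ ^ 2 := by
  have hsq : ContDiff ℝ 1 fun x => ‖φ x‖ ^ 2 := hφ.norm_sq ℝ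
  refine ⟨fun x => ‖φ x‖ ^ 2 • w x • x, hsq.smul (hw.smul contDiff_id),
    hφc.mono fun x hx h0 => hx (by simp [h0]), funext fun x => ?_⟩
  have hid : divergence (fun y : E => y) x = Module.finrank ℝ E := by
    simp [divergence, LinearMap.trace_id]
  have hφx := hφ.differentiable one_ne_zero x
  have hwx := hw.differentiable one_ne_zero x
  rw [divergence_smul (hsq.differentiable one_ne_zero x) (hwx.fun_smul differentiableAt_fun_id),
    divergence_smul hwx differentiableAt_fun_id, hid, hφx.hasFDerivAt.norm_sq.fderiv]
  simp
  ring

end NullForms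

section Hardy

variable {E H : Type*} [NormedAddCommGroup E] [InnerProductSpace ℝ E] [NormedAddCommGroup H]
  [InnerProductSpace ℝ H] {φ : E → H}

theorem hasFDerivAt_norm_sq (x : E) :
    HasFDerivAt (fun y : E => ‖y‖ ^ 2) ((2 : ℝ) • innerSL ℝ x) x := by
  simpa only [ofNat_smul_eq_nsmul] using (hasStrictFDerivAt_norm_sq x).hasFDerivAt

theorem fderiv_inv_one_add_norm_sq_apply_self (x : E) :
    fderiv ℝ (fun y : E => (1 + ‖y‖ ^ 2)⁻¹) x x = -2 * ‖x‖ ^ 2 * ((1 + ‖x‖ ^ 2)⁻¹) ^ 2 := by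
  have h := ((hasDerivAt_inv (x := 1 + ‖x‖ ^ 2) (by positivity)).comp_hasFDerivAt x
    ((hasFDerivAt_norm_sq x).const_add 1)).fderiv
  rw [Function.comp_def] at h
  simp only [h, smul_apply, innerSL_apply_apply, real_inner_self_eq_norm_sq, smul_eq_mul, inv_pow]
  ring

-- `ρ`, `t`, `d`, `p` and `n` stand for `‖x‖²`, `‖φ x‖`, `‖∂ₓφ‖`, `⟪φ x, ∂ₓφ⟫` and the dimension.
theorem hardy_pointwise {n ρ t G d p : ℝ} (hn : 4 ≤ n) (hρ : 0 ≤ ρ) (hG : 0 ≤ G)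
    (hd : d ^ 2 ≤ ρ * G) (hp : |p| ≤ t * d) :
    (1 + ρ)⁻¹ * t ^ 2 - G ≤
      2 * (1 + ρ)⁻¹ * p + (n * (1 + ρ)⁻¹ + -2 * ρ * ((1 + ρ)⁻¹) ^ 2) * t ^ 2 := by
  have hinv : (1 + ρ)⁻¹ * (1 + ρ) = 1 := inv_mul_cancel₀ (by positivity)
  have hpos : 0 < (1 + ρ)⁻¹ := by positivity
  generalize (1 + ρ)⁻¹ = w at *
  have hsq : 0 ≤ (1 + ρ) * G + 2 * p + t ^ 2 := by
    nlinarith [neg_abs_le p, sq_nonneg (d - t)]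
  have hrest : 0 ≤ (n - 4 + 2 * w) * t ^ 2 :=
    mul_nonneg (by linarith) (sq_nonneg t)
  have hscale : 2 * w * p + (n * w + -2 * ρ * w ^ 2) * t ^ 2 - (w * t ^ 2 - G) =
      w * ((1 + ρ) * G + 2 * p + t ^ 2 + (n - 4 + 2 * w) * t ^ 2) := by
    linear_combination (-G - 2 * w * t ^ 2) * hinv
  linarith [mul_nonneg hpos.le (add_nonneg hsq hrest)]

theorem integral_inv_one_add_norm_sq_mul_le [FiniteDimensional ℝ E]
    [MeasurableSpace E] [BorelSpace E] (μ : Measure E) [μ.IsAddHaarMeasure]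
    (hn : 4 ≤ Module.finrank ℝ E) (hφ : ContDiff ℝ 1 φ) (hφc : HasCompactSupport φ)
    {G : E → ℝ} (hG : Integrable G μ) (hG0 : ∀ x, 0 ≤ G x)
    (h : ∀ x, ‖fderiv ℝ φ x x‖ ^ 2 ≤ ‖x‖ ^ 2 * G x) :
    ∫ x, (1 + ‖x‖ ^ 2)⁻¹ * ‖φ x‖ ^ 2 ∂μ ≤ ∫ x, G x ∂μ := by
  have hw : ContDiff ℝ 1 fun x : E => (1 + ‖x‖ ^ 2)⁻¹ :=
    (contDiff_const.add (contDiff_norm_sq ℝ)).inv fun x => by positivity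
  have hint : Integrable (fun x => (1 + ‖x‖ ^ 2)⁻¹ * ‖φ x‖ ^ 2) μ :=
    (hw.continuous.mul (hφ.continuous.norm.pow 2)).integrable_of_hasCompactSupport
      (hφc.mono fun x hx h0 => hx (by simp [h0]))
  have hrad := isTotalDivergence_radialForm hw hφ hφc
  rw [← sub_nonpos, ← integral_sub hint hG, ← hrad.integral_eq_zero μ]
  refine integral_mono (hint.sub hG) (hrad.integrable μ) fun x => ?_
  simp only [fderiv_inv_one_add_norm_sq_apply_self]
  exact hardy_pointwise (by exact_mod_cast hn) (sq_nonneg _) (hG0 x) (h x)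
    (abs_real_inner_le_norm _ _)

end Hardy

section Translation
open Filter Topology

variable {E F : Type*} [NormedAddCommGroup E] [NormedSpace ℝ E] [FiniteDimensional ℝ E]
  [MeasurableSpace E] [BorelSpace E] {μ : Measure E} [μ.IsAddHaarMeasure] [NormedAddCommGroup F]

theorem tendsto_eLpNorm_translate_sub {p : ENNReal} (hp1 : 1 ≤ p) (hp : p ≠ ⊤)
    {u : E → F} (hu : MemLp u p μ) :
    Tendsto (fun z => eLpNorm (fun x => u (z + x) - u x) p μ) (𝓝 0) (𝓝 0) := by
  have : Fact (1 ≤ p) := ⟨hp1⟩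
  have : Fact (p ≠ ⊤) := ⟨hp⟩
  have hcont : Continuous fun z : E => DomAddAct.mk z +ᵥ hu.toLp :=
    DomAddAct.continuous_mk.vadd continuous_const
  have h := (hcont.edist (continuous_const (y := hu.toLp))).tendsto 0
  simp only [DomAddAct.mk_zero, zero_vadd, edist_self] at h
  refine h.congr fun z => ?_
  rw [DomAddAct.mk_vadd_toLp, Lp.edist_toLp_toLp]
  rfl

theorem eLpNorm_two_sq {α ε : Type*} [MeasurableSpace α] [ENorm ε] (μ : Measure α) (f : α → ε) :
    eLpNorm f 2 μ ^ 2 = ∫⁻ x, ‖f x‖ₑ ^ 2 ∂μ := by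
  simpa using eLpNorm_nnreal_pow_eq_lintegral (f := f) (μ := μ) (p := 2) two_ne_zero

theorem eLpNorm_lintegral_le {α β : Type*} [MeasurableSpace α] [MeasurableSpace β]
    {μ : Measure α} {ν : Measure β} [SFinite μ] [IsFiniteMeasure ν] {G : α → β → ENNReal}
    (hG : Measurable (Function.uncurry G)) {M : ENNReal}
    (h : ∀ᵐ s ∂ν, eLpNorm (fun x => G x s) 2 μ ≤ M) :
    eLpNorm (fun x => ∫⁻ s, G x s ∂ν) 2 μ ≤ ν Set.univ * M := by
  have hjensen (x : α) : (∫⁻ s, G x s ∂ν) ^ 2 ≤ ν Set.univ * ∫⁻ s, G x s ^ 2 ∂ν := by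
    have hholder := eLpNorm_le_eLpNorm_mul_rpow_measure_univ (μ := ν) (f := G x)
      (one_le_two (α := ENNReal)) (hG.of_uncurry_left).aestronglyMeasurable
    rw [eLpNorm_one_eq_lintegral_enorm] at hholder
    have hroot : (ν Set.univ ^ (1 / ENNReal.toReal 1 - 1 / ENNReal.toReal 2)) ^ 2 = ν Set.univ := by
      rw [← ENNReal.rpow_natCast, ← ENNReal.rpow_mul]
      norm_num
    calc (∫⁻ s, G x s ∂ν) ^ 2 ≤ _ := pow_le_pow_left' hholder 2
      _ = ν Set.univ * ∫⁻ s, G x s ^ 2 ∂ν := by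
        rw [mul_pow, hroot, eLpNorm_two_sq, mul_comm]
        rfl
  refine (ENNReal.pow_le_pow_left_iff two_ne_zero).1 ?_
  calc eLpNorm (fun x => ∫⁻ s, G x s ∂ν) 2 μ ^ 2
      ≤ ∫⁻ x, ν Set.univ * ∫⁻ s, G x s ^ 2 ∂ν ∂μ := by
        rw [eLpNorm_two_sq]; exact lintegral_mono hjensen
    _ = ν Set.univ * ∫⁻ s, ∫⁻ x, G x s ^ 2 ∂μ ∂ν := by
        have hG2 : Measurable (Function.uncurry fun x s => G x s ^ 2) := hG.pow_const 2
        rw [lintegral_const_mul _ hG2.lintegral_prod_right,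
          lintegral_lintegral_swap hG2.aemeasurable]
    _ ≤ ν Set.univ * ∫⁻ _, M ^ 2 ∂ν := by
        gcongr ν Set.univ * ?_
        refine lintegral_mono_ae (h.mono fun s hs => ?_)
        exact (eLpNorm_two_sq μ (G · s)).symm.trans_le (pow_le_pow_left' hs 2)
    _ = (ν Set.univ * M) ^ 2 := by rw [lintegral_const]; ring

theorem tendsto_iSup_eLpNorm_translate_sub {p : ENNReal} (hp1 : 1 ≤ p) (hp : p ≠ ⊤) {u : E → F}
    (hu : MemLp u p μ) {S : Set E} (hS : Bornology.IsBounded S) :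
    Tendsto (fun ε : ℝ => ⨆ s ∈ S, eLpNorm (fun x => u (x - ε • s) - u x) p μ) (𝓝 0) (𝓝 0) := by
  obtain ⟨R, hR⟩ := hS.exists_norm_le
  rw [ENNReal.tendsto_nhds_zero]
  intro δ hδ
  obtain ⟨r, hr, hball⟩ := Metric.eventually_nhds_iff.1
    (ENNReal.tendsto_nhds_zero.1 (tendsto_eLpNorm_translate_sub hp1 hp hu) δ hδ)
  have hsmall : ∀ᶠ ε : ℝ in 𝓝 0, |ε| * R < r :=
    (continuous_abs.mul continuous_const).tendsto' 0 0 (by simp) |>.eventually_lt_const hr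
  filter_upwards [hsmall] with ε hε
  refine iSup₂_le fun s hs => ?_
  have hdist : dist (-(ε • s)) 0 < r := by
    rw [dist_zero_right, norm_neg, norm_smul, Real.norm_eq_abs]
    exact (mul_le_mul_of_nonneg_left (hR s hs) (abs_nonneg ε)).trans_lt hε
  simpa only [neg_add_eq_sub] using hball hdist

theorem tendsto_eLpNorm_of_enorm_le_lintegral_sub {G : Type*} [NormedAddCommGroup G] {u : E → F}
    (hum : StronglyMeasurable u) (hu : MemLp u 2 μ) {S : Set E} (hS : Bornology.IsBounded S)
    (hSm : MeasurableSet S) {C : NNReal} {T : ℝ → E → G}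
    (hT : ∀ᶠ ε in 𝓝[>] 0, ∀ x, ‖T ε x‖ₑ ≤ C * ∫⁻ s in S, ‖u (x - ε • s) - u x‖ₑ ∂μ) :
    Tendsto (fun ε => eLpNorm (T ε) 2 μ) (𝓝[>] 0) (𝓝 0) := by
  have hfin : μ S < ⊤ := hS.measure_lt_top
  have : IsFiniteMeasure (μ.restrict S) := ⟨by rwa [Measure.restrict_apply_univ]⟩
  have hmeas (ε : ℝ) : Measurable (Function.uncurry fun x s => ‖u (x - ε • s) - u x‖ₑ) :=
    ((hum.comp_measurable (by fun_prop)).sub (hum.comp_measurable measurable_fst)).enorm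
  have hsup := (tendsto_iSup_eLpNorm_translate_sub one_le_two ENNReal.ofNat_ne_top hu hS).mono_left
    (nhdsWithin_le_nhds (s := Set.Ioi 0))
  have hlim := ENNReal.Tendsto.const_mul (a := C * μ S) hsup
    (.inr (ENNReal.mul_ne_top ENNReal.coe_ne_top hfin.ne))
  rw [mul_zero] at hlim
  refine tendsto_of_tendsto_of_tendsto_of_le_of_le' tendsto_const_nhds hlim
    (.of_forall fun _ => zero_le) (hT.mono fun ε hε => ?_)
  have hG : eLpNorm (fun x => ∫⁻ s in S, ‖u (x - ε • s) - u x‖ₑ ∂μ) 2 μ ≤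
      μ S * ⨆ s ∈ S, eLpNorm (fun x => u (x - ε • s) - u x) 2 μ := by
    rw [← Measure.restrict_apply_univ S]
    refine eLpNorm_lintegral_le (hmeas ε) ?_
    filter_upwards [ae_restrict_mem hSm] with s hs
    rw [eLpNorm_enorm]
    exact le_iSup₂ (f := fun s (_ : s ∈ S) => eLpNorm (fun x => u (x - ε • s) - u x) 2 μ) s hs
  have hTG : eLpNorm (T ε) 2 μ ≤ C * eLpNorm (fun x => ∫⁻ s in S, ‖u (x - ε • s) - u x‖ₑ ∂μ) 2 μ :=
    eLpNorm_le_nnreal_smul_eLpNorm_of_ae_le_mul' (.of_forall hε) 2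
  rw [mul_assoc]
  exact hTG.trans (mul_le_mul_right hG _)

end Translation

section Mollifier
open Filter Topology Metric Module

variable {E F : Type*} [NormedAddCommGroup E] [NormedSpace ℝ E]
  [MeasurableSpace E] {μ : Measure E} {η : E → ℝ} {ε : ℝ}
  [NormedAddCommGroup F] [NormedSpace ℝ F] {u : E → F}

/-- `η` is a mollifier: a smooth function of mass one supported in the closed unit ball. -/
structure IsMollifier (μ : Measure E) (η : E → ℝ) : Prop where
  contDiff : ContDiff ℝ ∞ η
  tsupport_subset : tsupport η ⊆ closedBall 0 1
  integral_eq_one : ∫ x, η x ∂μ = 1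

/-- The rescaled kernel `z ↦ ε⁻ⁿ η (z / ε)`, where `n` is the dimension. -/
def rescale (η : E → ℝ) (ε : ℝ) (z : E) : ℝ := (ε ^ finrank ℝ E)⁻¹ * η (ε⁻¹ • z)

/-- The mollification of `u` at scale `ε`: its convolution with the rescaled kernel. -/
def mollify (μ : Measure E) (η : E → ℝ) (ε : ℝ) (u : E → F) (x : E) : F :=
  ∫ y, rescale η ε (x - y) • u y ∂μ

namespace IsMollifier

theorem contDiff_rescale (hη : IsMollifier μ η) (ε : ℝ) : ContDiff ℝ ∞ (rescale η ε) :=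
  contDiff_const.mul (hη.contDiff.comp (contDiff_const_smul _))

theorem fderiv_rescale (hη : IsMollifier μ η) (ε : ℝ) (z v : E) :
    fderiv ℝ (rescale η ε) z v = (ε ^ finrank ℝ E)⁻¹ * fderiv ℝ η (ε⁻¹ • z) (ε⁻¹ • v) := by
  have h := (((hη.contDiff.differentiable (by simp)) (ε⁻¹ • z)).hasFDerivAt.comp z
    ((hasFDerivAt_id z).const_smul ε⁻¹)).const_mul (ε ^ finrank ℝ E)⁻¹
  exact DFunLike.congr_fun h.fderiv v

theorem tsupport_rescale_subset (hη : IsMollifier μ η) (hε : 0 < ε) :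
    tsupport (rescale η ε) ⊆ closedBall 0 ε := by
  refine closure_minimal (fun z hz => ?_) isClosed_closedBall
  have h := hη.tsupport_subset (subset_tsupport η (right_ne_zero_of_mul hz))
  rw [mem_closedBall_zero_iff, norm_smul, norm_inv, Real.norm_of_nonneg hε.le,
    inv_mul_le_one₀ hε] at h
  exact mem_closedBall_zero_iff.2 h

theorem contDiff_rescale_sub (hη : IsMollifier μ η) (ε : ℝ) (x : E) :
    ContDiff ℝ ∞ fun y => rescale η ε (x - y) :=
  (hη.contDiff_rescale ε).comp (contDiff_const.sub contDiff_id)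

theorem fderiv_rescale_sub (hη : IsMollifier μ η) (ε : ℝ) (x y v : E) :
    fderiv ℝ (fun y => rescale η ε (x - y)) y v = -fderiv ℝ (rescale η ε) (x - y) v := by
  have h := ((hη.contDiff_rescale ε).differentiable (by simp) (x - y)).hasFDerivAt.comp y
    ((hasFDerivAt_id y).const_sub x)
  exact (DFunLike.congr_fun h.fderiv v).trans (map_neg (fderiv ℝ (rescale η ε) (x - y)) v)

theorem rescale_sub_eq_zero (hη : IsMollifier μ η) (hε : 0 < ε) {x y : E}
    (hy : y ∉ closedBall x ε) :
    rescale η ε (x - y) = 0 ∧ fderiv ℝ (rescale η ε) (x - y) = 0 := by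
  have hxy : x - y ∉ tsupport (rescale η ε) := fun h => hy <| by
    rw [mem_closedBall', dist_eq_norm]
    exact mem_closedBall_zero_iff.1 (hη.tsupport_rescale_subset hε h)
  exact ⟨image_eq_zero_of_notMem_tsupport hxy,
    image_eq_zero_of_notMem_tsupport fun h => hxy (tsupport_fderiv_subset ℝ h)⟩

theorem mollify_eq_zero (hη : IsMollifier μ η) (hε : 0 < ε) {x : E}
    (hu : ∀ y ∈ closedBall x ε, u y = 0) : mollify μ η ε u x = 0 := by
  refine integral_eq_zero_of_ae (.of_forall fun y => ?_)
  by_cases hy : y ∈ closedBall x ε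
  · simp [hu y hy]
  · simp [(hη.rescale_sub_eq_zero hε hy).1]

variable [FiniteDimensional ℝ E]

theorem hasCompactSupport (hη : IsMollifier μ η) : HasCompactSupport η :=
  (isCompact_closedBall 0 1).of_isClosed_subset (isClosed_tsupport η) hη.tsupport_subset

theorem hasCompactSupport_rescale (hη : IsMollifier μ η) (hε : 0 < ε) :
    HasCompactSupport (rescale η ε) :=
  (hη.hasCompactSupport.comp_smul (inv_ne_zero hε.ne')).mul_left (f := fun _ => _)

theorem hasCompactSupport_rescale_sub (hη : IsMollifier μ η) (hε : 0 < ε) (x : E) :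
    HasCompactSupport fun y => rescale η ε (x - y) :=
  (hη.hasCompactSupport_rescale hε).comp_homeomorph (Homeomorph.subLeft x)

theorem exists_bound (hη : IsMollifier μ η) : ∃ C, ∀ z, |η z| ≤ C ∧ ‖fderiv ℝ η z‖ ≤ C := by
  obtain ⟨C₀, h₀⟩ := hη.hasCompactSupport.exists_bound_of_continuous hη.contDiff.continuous
  obtain ⟨C₁, h₁⟩ := (hη.hasCompactSupport.fderiv ℝ).exists_bound_of_continuous
    (hη.contDiff.continuous_fderiv (by simp))
  exact ⟨max C₀ C₁, fun z => ⟨(h₀ z).trans (le_max_left _ _), (h₁ z).trans (le_max_right _ _)⟩⟩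

theorem hasCompactSupport_mollify (hη : IsMollifier μ η) (hε : 0 < ε) (hu : HasCompactSupport u) :
    HasCompactSupport (mollify μ η ε u) :=
  hu.convolution (ContinuousLinearMap.lsmul ℝ ℝ).flip (hη.hasCompactSupport_rescale hε)

variable [BorelSpace E]

theorem contDiff_mollify (hη : IsMollifier μ η) (hε : 0 < ε) (hu : LocallyIntegrable u μ) :
    ContDiff ℝ ∞ (mollify μ η ε u) :=
  (hη.hasCompactSupport_rescale hε).contDiff_convolution_right
    (ContinuousLinearMap.lsmul ℝ ℝ).flip hu (hη.contDiff_rescale ε)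

variable [μ.IsAddHaarMeasure]

theorem integral_rescale_sub (hη : IsMollifier μ η) (hε : 0 < ε) (x : E) :
    ∫ y, rescale η ε (x - y) ∂μ = 1 := by
  rw [integral_sub_left_eq_self (rescale η ε) μ]
  simp only [rescale]
  rw [integral_const_mul, Measure.integral_comp_inv_smul_of_nonneg _ _ hε.le, hη.integral_eq_one,
    smul_eq_mul, mul_one, inv_mul_cancel₀ (by positivity)]

theorem fderiv_mollify (hη : IsMollifier μ η) (hε : 0 < ε) (hu : LocallyIntegrable u μ) (x v : E) :
    fderiv ℝ (mollify μ η ε u) x v = ∫ y, fderiv ℝ (rescale η ε) (x - y) v • u y ∂μ := by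
  have hc := hη.hasCompactSupport_rescale hε
  have h := (hc.hasFDerivAt_convolution_right (ContinuousLinearMap.lsmul ℝ ℝ (E := F)).flip hu
    ((hη.contDiff_rescale ε).of_le (by simp)) x).fderiv
  exact (DFunLike.congr_fun h v).trans (convolution_precompR_apply _ hu (hc.fderiv ℝ)
    ((hη.contDiff_rescale ε).continuous_fderiv (by simp)) x v)

end IsMollifier

variable [FiniteDimensional ℝ E] [BorelSpace E]

theorem exists_isMollifier (μ : Measure E) [μ.IsAddHaarMeasure] : ∃ η, IsMollifier μ η := by
  let bump : ContDiffBump (0 : E) := ⟨1 / 2, 1, by norm_num, by norm_num⟩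
  exact ⟨bump.normed μ, bump.contDiff_normed, bump.tsupport_normed_eq.subset, bump.integral_normed⟩

theorem setLIntegral_closedBall_eq [μ.IsAddHaarMeasure] (hε : 0 < ε) (x : E) (g : E → ENNReal) :
    ENNReal.ofReal (ε ^ finrank ℝ E)⁻¹ * ∫⁻ y in closedBall x ε, g y ∂μ =
      ∫⁻ s in closedBall 0 1, g (x - ε • s) ∂μ := by
  let e : E ≃ₜ E := (Homeomorph.smulOfNeZero ε hε.ne').trans (Homeomorph.subLeft x)
  have hmap : μ.map e = ENNReal.ofReal (ε ^ finrank ℝ E)⁻¹ • μ := by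
    have hcomp := Measure.map_map (μ := μ) (measurable_const_sub x) (measurable_const_smul ε)
    rw [Measure.map_addHaar_smul μ hε.ne', Measure.map_smul, abs_of_pos (by positivity),
      Measure.map_sub_left_eq_self] at hcomp
    exact hcomp.symm
  have hpre : e ⁻¹' closedBall x ε = closedBall 0 1 := by
    ext s
    simp [e, dist_eq_norm, norm_smul, abs_of_pos hε, mul_le_iff_le_one_right hε]
  rw [← smul_eq_mul, ← lintegral_smul_measure, ← Measure.restrict_smul, ← hmap,
    e.measurableEmbedding.restrict_map, e.measurableEmbedding.lintegral_map, hpre]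
  rfl

theorem enorm_integral_smul_sub_le [μ.IsAddHaarMeasure] (hε : 0 < ε) {x : E} {k : E → ℝ}
    {C : NNReal} (hk0 : ∀ y ∉ closedBall x ε, k y = 0)
    (hk : ∀ y ∈ closedBall x ε, u y ≠ u x → |k y| ≤ C * (ε ^ finrank ℝ E)⁻¹) :
    ‖∫ y, k y • (u y - u x) ∂μ‖ₑ ≤ C * ∫⁻ s in closedBall 0 1, ‖u (x - ε • s) - u x‖ₑ ∂μ := by
  have hpt (y : E) : ‖k y • (u y - u x)‖ₑ ≤ (closedBall x ε).indicator
      (fun y => C * (ENNReal.ofReal (ε ^ finrank ℝ E)⁻¹ * ‖u y - u x‖ₑ)) y := by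
    by_cases hy : y ∈ closedBall x ε
    · rw [Set.indicator_of_mem hy, ← mul_assoc, enorm_smul]
      obtain huy | huy := eq_or_ne (u y) (u x)
      · simp [huy]
      · gcongr
        rw [← ENNReal.ofReal_coe_nnreal, ← ENNReal.ofReal_mul C.coe_nonneg,
          Real.enorm_eq_ofReal_abs]
        exact ENNReal.ofReal_le_ofReal (hk y hy huy)
    · simp [hk0 y hy]
  calc ‖∫ y, k y • (u y - u x) ∂μ‖ₑ
      ≤ ∫⁻ y, ‖k y • (u y - u x)‖ₑ ∂μ := enorm_integral_le_lintegral_enorm _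
    _ ≤ _ := lintegral_mono hpt
    _ = C * ∫⁻ s in closedBall 0 1, ‖u (x - ε • s) - u x‖ₑ ∂μ := by
      rw [lintegral_indicator isClosed_closedBall.measurableSet,
        lintegral_const_mul' _ _ ENNReal.coe_ne_top, lintegral_const_mul' _ _ ENNReal.ofReal_ne_top,
        setLIntegral_closedBall_eq hε x fun y => ‖u y - u x‖ₑ]

end Mollifier

/-! ### Friedrichs' lemma -/

section Friedrichs
open Filter Topology Metric Module

variable {E F : Type*} [NormedAddCommGroup E] [NormedSpace ℝ E] {w : E → E} {η : E → ℝ} {ε : ℝ}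

/-- The integral kernel of the commutator of `∂_w` with mollification at scale `ε`. -/
def friedrichsKernel (η : E → ℝ) (w : E → E) (ε : ℝ) (x y : E) : ℝ :=
  fderiv ℝ (rescale η ε) (x - y) (w x - w y) + divergence w y * rescale η ε (x - y)

variable [MeasurableSpace E] {μ : Measure E}

theorem friedrichsKernel_eq_zero (hη : IsMollifier μ η) (hε : 0 < ε) {x y : E}
    (hy : y ∉ closedBall x ε) : friedrichsKernel η w ε x y = 0 := by
  obtain ⟨h₀, h₁⟩ := hη.rescale_sub_eq_zero hε hy
  simp [friedrichsKernel, h₀, h₁]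

variable [FiniteDimensional ℝ E]

theorem continuous_friedrichsKernel (hη : IsMollifier μ η) (hw : ContDiff ℝ 1 w) (x : E) :
    Continuous (friedrichsKernel η w ε x) := by
  have hsub : Continuous fun y => x - y := continuous_const.sub continuous_id
  exact ((((hη.contDiff_rescale ε).continuous_fderiv (by simp)).comp hsub).clm_apply
    (continuous_const.sub hw.continuous)).add
      ((continuous_divergence hw).mul ((hη.contDiff_rescale ε).continuous.comp hsub))

theorem hasCompactSupport_friedrichsKernel (hη : IsMollifier μ η) (hε : 0 < ε) (x : E) :
    HasCompactSupport (friedrichsKernel η w ε x) :=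
  .intro (isCompact_closedBall x ε) fun _ => friedrichsKernel_eq_zero hη hε

theorem exists_friedrichsKernel_le (hη : IsMollifier μ η) (hw : ContDiff ℝ 1 w) (R : ℝ) :
    ∃ C : NNReal, ∀ ε > 0, ∀ x ∈ closedBall (0 : E) R, ∀ y ∈ closedBall (0 : E) R,
      y ∈ closedBall x ε → |friedrichsKernel η w ε x y| ≤ C * (ε ^ finrank ℝ E)⁻¹ := by
  obtain ⟨M, hM⟩ := hη.exists_bound
  obtain ⟨L, hL⟩ := (isCompact_closedBall (0 : E) R).exists_bound_of_continuousOn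
    (hw.continuous_fderiv one_ne_zero).continuousOn
  obtain ⟨D, hD⟩ := (isCompact_closedBall (0 : E) R).exists_bound_of_continuousOn
    (continuous_divergence hw).continuousOn
  refine ⟨(M * L + D * M).toNNReal, fun ε hε x hx y hy hyx => ?_⟩
  have hM0 : 0 ≤ M := (abs_nonneg _).trans (hM 0).1
  have hL0 : 0 ≤ L := (norm_nonneg _).trans (hL x hx)
  have hlip : ‖ε⁻¹ • (w x - w y)‖ ≤ L := by
    have h := (convex_closedBall (0 : E) R).norm_image_sub_le_of_norm_fderiv_le
      (fun z _ => hw.differentiable one_ne_zero z) hL hy hx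
    rw [mem_closedBall', dist_eq_norm] at hyx
    rw [norm_smul, norm_inv, Real.norm_of_nonneg hε.le, inv_mul_le_iff₀ hε, mul_comm]
    exact h.trans (mul_le_mul_of_nonneg_left hyx hL0)
  have hderiv : |fderiv ℝ η (ε⁻¹ • (x - y)) (ε⁻¹ • (w x - w y))| ≤ M * L :=
    (fderiv ℝ η _).le_of_opNorm_le_of_le (hM _).2 hlip
  have hzero : |divergence w y * η (ε⁻¹ • (x - y))| ≤ D * M := by
    rw [abs_mul]
    exact mul_le_mul (hD y hy) (hM _).1 (abs_nonneg _) ((norm_nonneg _).trans (hD y hy))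
  have hfactor : friedrichsKernel η w ε x y = (ε ^ finrank ℝ E)⁻¹ *
      (fderiv ℝ η (ε⁻¹ • (x - y)) (ε⁻¹ • (w x - w y)) + divergence w y * η (ε⁻¹ • (x - y))) := by
    rw [friedrichsKernel, hη.fderiv_rescale, rescale]
    ring
  rw [hfactor, abs_mul, abs_of_pos (by positivity : 0 < (ε ^ finrank ℝ E)⁻¹), mul_comm]
  gcongr
  exact (abs_add_le _ _).trans ((add_le_add hderiv hzero).trans (Real.le_coe_toNNReal _))

variable [BorelSpace E] [μ.IsAddHaarMeasure]

theorem integral_friedrichsKernel (hη : IsMollifier μ η) (hε : 0 < ε) (hw : ContDiff ℝ 1 w)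
    (x : E) : ∫ y, friedrichsKernel η w ε x y ∂μ = 0 := by
  rw [← integral_fderiv_add_divergence_mul μ (w := fun y => w y - w x)
    ((hη.contDiff_rescale_sub ε x).of_le (by simp)) (hη.hasCompactSupport_rescale_sub hε x)
    (hw.sub contDiff_const)]
  refine integral_congr_ae (.of_forall fun y => ?_)
  have hdiv : divergence (fun y => w y - w x) y = divergence w y := by
    rw [divergence, fderiv_sub_const, divergence]
  simp only [friedrichsKernel, hdiv, hη.fderiv_rescale_sub, ← map_neg, neg_sub]

variable [NormedAddCommGroup F] [NormedSpace ℝ F] [CompleteSpace F] {u g : E → F}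

theorem exists_enorm_integral_friedrichsKernel_le (hη : IsMollifier μ η) (hw : ContDiff ℝ 1 w)
    (hu : LocallyIntegrable u μ) (huc : HasCompactSupport u) :
    ∃ C : NNReal, ∀ ε ∈ Set.Ioc (0 : ℝ) 1, ∀ x, ‖∫ y, friedrichsKernel η w ε x y • u y ∂μ‖ₑ ≤
      C * ∫⁻ s in closedBall 0 1, ‖u (x - ε • s) - u x‖ₑ ∂μ := by
  obtain ⟨R, hR⟩ := huc.isBounded.exists_norm_le
  have hfar (z : E) (hz : R < ‖z‖) : u z = 0 :=
    image_eq_zero_of_notMem_tsupport fun h => hz.not_ge (hR z h)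
  obtain ⟨C, hC⟩ := exists_friedrichsKernel_le hη hw (R + 1)
  refine ⟨C, fun ε ⟨hε, hε1⟩ x => ?_⟩
  have hK := continuous_friedrichsKernel (ε := ε) hη hw x
  have hKc := hasCompactSupport_friedrichsKernel (w := w) hη hε x
  have hsub : ∫ y, friedrichsKernel η w ε x y • u y ∂μ =
      ∫ y, friedrichsKernel η w ε x y • (u y - u x) ∂μ := by
    simp only [smul_sub]
    rw [integral_sub (hu.integrable_smul_left_of_hasCompactSupport hK hKc)
      ((hK.integrable_of_hasCompactSupport hKc).smul_const (u x)), integral_smul_const,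
      integral_friedrichsKernel hη hε hw, zero_smul, sub_zero]
  rw [hsub]
  refine enorm_integral_smul_sub_le hε (fun y => friedrichsKernel_eq_zero hη hε) ?_
  intro y hy huy
  have hxy : ‖x - y‖ ≤ 1 := by
    rw [mem_closedBall', dist_eq_norm] at hy
    exact hy.trans hε1
  obtain h | h : ‖x‖ ≤ R ∨ ‖y‖ ≤ R := by
    by_contra! h
    exact huy (by rw [hfar x h.1, hfar y h.2])
  · refine hC ε hε x (mem_closedBall_zero_iff.2 (by linarith)) y
      (mem_closedBall_zero_iff.2 ?_) hy
    linarith [norm_sub_norm_le y x, norm_sub_rev x y]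
  · refine hC ε hε x (mem_closedBall_zero_iff.2 ?_) y (mem_closedBall_zero_iff.2 (by linarith)) hy
    linarith [norm_sub_norm_le x y]

theorem tendsto_eLpNorm_mollify_sub (hη : IsMollifier μ η) (hum : StronglyMeasurable u)
    (hu : MemLp u 2 μ) :
    Tendsto (fun ε => eLpNorm (fun x => mollify μ η ε u x - u x) 2 μ) (𝓝[>] 0) (𝓝 0) := by
  obtain ⟨M, hM⟩ := hη.exists_bound
  refine tendsto_eLpNorm_of_enorm_le_lintegral_sub hum hu (S := closedBall 0 1)
    isBounded_closedBall isClosed_closedBall.measurableSet (C := M.toNNReal) ?_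
  filter_upwards [self_mem_nhdsWithin] with ε hε x
  have hε : 0 < ε := hε
  have hρ := (hη.contDiff_rescale_sub ε x).continuous
  have hρc := hη.hasCompactSupport_rescale_sub hε x
  have hsub : mollify μ η ε u x - u x = ∫ y, rescale η ε (x - y) • (u y - u x) ∂μ := by
    simp only [smul_sub]
    rw [integral_sub ((hu.locallyIntegrable one_le_two).integrable_smul_left_of_hasCompactSupport
      hρ hρc) ((hρ.integrable_of_hasCompactSupport hρc).smul_const (u x)), integral_smul_const,
      hη.integral_rescale_sub hε, one_smul, mollify]
  rw [hsub]
  refine enorm_integral_smul_sub_le hε (fun y hy => (hη.rescale_sub_eq_zero hε hy).1) ?_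
  intro y _ _
  rw [rescale, abs_mul, abs_of_pos (by positivity : 0 < (ε ^ finrank ℝ E)⁻¹), mul_comm]
  gcongr
  exact (hM _).1.trans (Real.le_coe_toNNReal M)

end Friedrichs

section WeakImage
open Filter Topology Metric

variable {ι E F : Type*} [Fintype ι] [NormedAddCommGroup E] [NormedSpace ℝ E]
  [NormedAddCommGroup F] [NormedSpace ℝ F] {w : ι → E → E} {c : ι → F →L[ℝ] F} {u g : E → F}

/-- The homogeneous first-order operator `φ ↦ ∑ᵢ cᵢ ∂_{wᵢ} φ` with constant coefficients `cᵢ`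
along the vector fields `wᵢ`. -/
def firstOrder (w : ι → E → E) (c : ι → F →L[ℝ] F) (φ : E → F) (x : E) : F :=
  ∑ i, c i (fderiv ℝ φ x (w i x))

variable [MeasurableSpace E] {μ : Measure E}

/-- `∑ᵢ cᵢ ∂_{wᵢ} u = g` in the sense of distributions, with the derivatives moved to scalar test
functions. -/
def HasWeakImage (μ : Measure E) (w : ι → E → E) (c : ι → F →L[ℝ] F) (u g : E → F) : Prop :=
  ∀ k : E → ℝ, ContDiff ℝ ∞ k → HasCompactSupport k →
    ∫ x, ∑ i, -divergence (fun y => k y • w i y) x • c i (u x) ∂μ = ∫ x, k x • g x ∂μ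

variable [FiniteDimensional ℝ E] [BorelSpace E]

theorem integrable_divergence_smul {k : E → ℝ} {v : E → E} (hk : ContDiff ℝ 1 k)
    (hkc : HasCompactSupport k) (hv : ContDiff ℝ 1 v) (hu : LocallyIntegrable u μ) :
    Integrable (fun x => divergence (fun y => k y • v y) x • u x) μ :=
  hu.integrable_smul_left_of_hasCompactSupport (continuous_divergence (hk.smul hv))
    (hasCompactSupport_divergence (hkc.smul_right (f' := v)))

theorem HasWeakImage.smul (hw : ∀ i, ContDiff ℝ 1 (w i)) (hu : LocallyIntegrable u μ)
    (hg : LocallyIntegrable g μ) (h : HasWeakImage μ w c u g) {χ : E → ℝ} (hχ : ContDiff ℝ ∞ χ) :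
    HasWeakImage μ w c (fun x => χ x • u x)
      fun x => χ x • g x + ∑ i, fderiv ℝ χ x (w i x) • c i (u x) := by
  intro k hk hkc
  have hkχ : ContDiff ℝ ∞ fun x => k x * χ x := hk.mul hχ
  have hgint : Integrable (fun x => (k x * χ x) • g x) μ :=
    hg.integrable_smul_left_of_hasCompactSupport hkχ.continuous hkc.mul_right
  have hχint : Integrable (fun x => ∑ i, (k x * fderiv ℝ χ x (w i x)) • c i (u x)) μ :=
    integrable_finsetSum _ fun i _ => ((c i).integrable_comp
      (hu.integrable_smul_left_of_hasCompactSupport (hk.continuous.mul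
        ((hχ.continuous_fderiv (by simp)).clm_apply (hw i).continuous))
        hkc.mul_right)).congr (.of_forall fun x => by simp)
  have hdiv : Integrable
      (fun x => ∑ i, -divergence (fun y => (k y * χ y) • w i y) x • c i (u x)) μ :=
    integrable_finsetSum _ fun i _ => ((c i).integrable_comp (integrable_divergence_smul
      (hkχ.of_le (by simp)) hkc.mul_right (hw i) hu).neg).congr (.of_forall fun x => by simp)
  have hsplit : ∫ x, k x • (χ x • g x + ∑ i, fderiv ℝ χ x (w i x) • c i (u x)) ∂μ =
      ∫ x, (k x * χ x) • g x ∂μ + ∫ x, ∑ i, (k x * fderiv ℝ χ x (w i x)) • c i (u x) ∂μ := by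
    rw [← integral_add hgint hχint]
    simp only [smul_add, Finset.smul_sum, smul_smul]
  rw [hsplit, ← h _ hkχ hkc.mul_right, ← integral_add hdiv hχint]
  refine integral_congr_ae (.of_forall fun x => ?_)
  have hkx := hk.differentiable (by simp) x
  have hχx := hχ.differentiable (by simp) x
  simp only [map_smul, smul_smul, ← Finset.sum_add_distrib, ← add_smul]
  refine Finset.sum_congr rfl fun i _ => congrArg (· • c i (u x)) ?_
  have hwx := (hw i).differentiable one_ne_zero x
  rw [divergence_smul hkx hwx, divergence_smul (hkx.fun_mul hχx) hwx, fderiv_fun_mul hkx hχx]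
  simp only [add_apply, smul_apply, smul_eq_mul]
  ring

variable [CompleteSpace F] [μ.IsAddHaarMeasure] {η : E → ℝ} {ε : ℝ}

theorem HasWeakImage.firstOrder_mollify_sub (hη : IsMollifier μ η) (hε : 0 < ε)
    (hw : ∀ i, ContDiff ℝ 1 (w i)) (hu : LocallyIntegrable u μ) (h : HasWeakImage μ w c u g)
    (x : E) :
    firstOrder w c (mollify μ η ε u) x - mollify μ η ε g x =
      ∑ i, c i (∫ y, friedrichsKernel η (w i) ε x y • u y ∂μ) := by
  have hk := hη.contDiff_rescale_sub ε x
  have hkc := hη.hasCompactSupport_rescale_sub hε x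
  have hdiv (i : ι) := integrable_divergence_smul (hk.of_le (by simp)) hkc (hw i) hu
  have hderiv (i : ι) : Integrable (fun y => fderiv ℝ (rescale η ε) (x - y) (w i x) • u y) μ := by
    refine hu.integrable_smul_left_of_hasCompactSupport ?_ ?_
    · exact ((hη.contDiff_rescale ε).continuous_fderiv (by simp)).comp
        (continuous_const.sub continuous_id) |>.clm_apply continuous_const
    · exact ((hη.hasCompactSupport_rescale hε).fderiv_apply (𝕜 := ℝ) (w i x)).comp_homeomorph
        (Homeomorph.subLeft x)
  have hg : mollify μ η ε g x =
      ∑ i, c i (-∫ y, divergence (fun y => rescale η ε (x - y) • w i y) y • u y ∂μ) := by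
    rw [mollify, ← h _ hk hkc, integral_finsetSum]
    · refine Finset.sum_congr rfl fun i _ => ?_
      rw [← integral_neg]
      refine Eq.trans ?_ ((c i).integral_comp_comm (hdiv i).neg)
      exact integral_congr_ae (.of_forall fun y => by simp)
    · exact fun i _ => ((c i).integrable_comp (hdiv i).neg).congr (.of_forall fun y => by simp)
  rw [hg, firstOrder, ← Finset.sum_sub_distrib]
  refine Finset.sum_congr rfl fun i _ => ?_
  rw [hη.fderiv_mollify hε hu, ← map_sub, sub_neg_eq_add, ← integral_add (hderiv i) (hdiv i)]
  congr 1
  refine integral_congr_ae (.of_forall fun y => ?_)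
  dsimp only
  rw [← add_smul, divergence_smul (hk.differentiable (by simp) y)
    ((hw i).differentiable one_ne_zero y), hη.fderiv_rescale_sub, friedrichsKernel, map_sub]
  congr 1
  ring

theorem HasWeakImage.tendsto_eLpNorm_firstOrder_mollify_sub (hη : IsMollifier μ η)
    (hw : ∀ i, ContDiff ℝ 1 (w i)) (hum : StronglyMeasurable u) (hu : MemLp u 2 μ)
    (huc : HasCompactSupport u) (h : HasWeakImage μ w c u g) :
    Tendsto (fun ε => eLpNorm (fun x => firstOrder w c (mollify μ η ε u) x - mollify μ η ε g x)
      2 μ) (𝓝[>] 0) (𝓝 0) := by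
  have hloc := hu.locallyIntegrable one_le_two
  choose C hC using fun i => exists_enorm_integral_friedrichsKernel_le hη (hw i) hloc huc
  refine tendsto_eLpNorm_of_enorm_le_lintegral_sub hum hu (S := closedBall 0 1)
    isBounded_closedBall isClosed_closedBall.measurableSet (C := ∑ i, ‖c i‖₊ * C i) ?_
  filter_upwards [Ioc_mem_nhdsGT one_pos] with ε hε x
  rw [h.firstOrder_mollify_sub hη hε.1 hw hloc, ENNReal.ofNNReal_finsetSum, Finset.sum_mul]
  refine (enorm_sum_le _ _).trans (Finset.sum_le_sum fun i _ => ?_)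
  rw [ENNReal.coe_mul, mul_assoc]
  exact ((c i).le_opENorm _).trans (mul_le_mul_right (hC i ε hε x) _)

end WeakImage

section Vanishing
open Filter Topology Metric

variable {ι E F : Type*} [Fintype ι] [NormedAddCommGroup E] [NormedSpace ℝ E]
  [NormedAddCommGroup F] [NormedSpace ℝ F]
  {w : ι → E → E} {c : ι → F →L[ℝ] F} {u g : E → F} {B : E → F →L[ℝ] F} {q : E → ℝ} {η : E → ℝ}

theorem continuous_firstOrder (hw : ∀ i, ContDiff ℝ 1 (w i)) {φ : E → F} (hφ : ContDiff ℝ ∞ φ) :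
    Continuous (firstOrder w c φ) :=
  continuous_finsetSum _ fun i _ => (c i).continuous.comp
    ((hφ.continuous_fderiv (by simp)).clm_apply (hw i).continuous)

variable [MeasurableSpace E] [BorelSpace E] {μ : Measure E} [FiniteDimensional ℝ E]

theorem memLp_clm_apply {A : E → F →L[ℝ] F} (hA : Continuous A) (hAc : HasCompactSupport A)
    (hu : MemLp u 2 μ) : MemLp (fun x => A x (u x)) 2 μ := by
  obtain ⟨M, hM⟩ := hAc.exists_bound_of_continuous hA
  have hum := hu.aestronglyMeasurable
  exact hu.of_le_mul (c := M) (by fun_prop) (.of_forall fun x => (A x).le_of_opNorm_le (hM x) _)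

theorem locallyIntegrable_clm_apply {A : E → F →L[ℝ] F} (hA : Continuous A)
    (hu : LocallyIntegrable u μ) : LocallyIntegrable (fun x => A x (u x)) μ := by
  refine locallyIntegrable_iff.2 fun K hK => ?_
  obtain ⟨M, hM⟩ := hK.exists_bound_of_continuousOn hA.continuousOn
  have hint := hu.integrableOn_isCompact hK
  have hum := hint.aestronglyMeasurable
  refine Integrable.mono' (hint.norm.const_mul M) (by fun_prop) ?_
  filter_upwards [ae_restrict_mem hK.measurableSet] with x hx
  exact (A x).le_of_opNorm_le (hM x hx) _

omit [NormedSpace ℝ E] [FiniteDimensional ℝ E] in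
theorem eLpNorm_smul_le_add (hq : Continuous q) (hq1 : ∀ x, |q x| ≤ 1) {v : E → F}
    (hv : AEStronglyMeasurable v μ) (hu : AEStronglyMeasurable u μ) :
    eLpNorm (fun x => q x • u x) 2 μ ≤
      eLpNorm (fun x => q x • v x) 2 μ + eLpNorm (fun x => v x - u x) 2 μ := by
  have hle : eLpNorm (fun x => q x • (v x - u x)) 2 μ ≤ eLpNorm (fun x => v x - u x) 2 μ :=
    eLpNorm_mono fun x => by
      rw [norm_smul]
      exact mul_le_of_le_one_left (norm_nonneg _) (hq1 x)
  calc eLpNorm (fun x => q x • u x) 2 μ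
      = eLpNorm (fun x => q x • v x - q x • (v x - u x)) 2 μ := by simp [smul_sub]
    _ ≤ _ := (eLpNorm_sub_le (by fun_prop) (by fun_prop) one_le_two).trans (add_le_add le_rfl hle)

variable [CompleteSpace F] [μ.IsAddHaarMeasure]

theorem tendsto_eLpNorm_clm_mollify_sub (hη : IsMollifier μ η) (hum : StronglyMeasurable u)
    (hu : MemLp u 2 μ) (huc : HasCompactSupport u) (hB : Continuous B) :
    Tendsto (fun ε => eLpNorm (fun x => B x (mollify μ η ε u x - u x)) 2 μ) (𝓝[>] 0) (𝓝 0) := by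
  obtain ⟨R, hR⟩ := huc.isBounded.exists_norm_le
  obtain ⟨M, hM⟩ := (isCompact_closedBall (0 : E) (R + 1)).exists_bound_of_continuousOn
    hB.continuousOn
  have hlim := ENNReal.Tendsto.const_mul (a := M.toNNReal)
    (tendsto_eLpNorm_mollify_sub hη hum hu) (.inr ENNReal.coe_ne_top)
  rw [mul_zero] at hlim
  refine tendsto_of_tendsto_of_tendsto_of_le_of_le' tendsto_const_nhds hlim
    (.of_forall fun _ => zero_le) ?_
  filter_upwards [Ioc_mem_nhdsGT one_pos] with ε ⟨hε, hε1⟩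
  refine eLpNorm_le_nnreal_smul_eLpNorm_of_ae_le_mul (.of_forall fun x => ?_) 2
  by_cases hx : x ∈ closedBall 0 (R + 1)
  · exact (B x).le_of_opNorm_le ((hM x hx).trans (Real.le_coe_toNNReal M)) _
  · have hzero (y : E) (hy : y ∈ closedBall x ε) : u y = 0 := by
      refine image_eq_zero_of_notMem_tsupport fun hyu => hx (mem_closedBall_zero_iff.2 ?_)
      rw [mem_closedBall', dist_eq_norm] at hy
      linarith [hR y hyu, norm_sub_norm_le x y]
    simp [hη.mollify_eq_zero hε hzero, hzero x (mem_closedBall_self hε.le)]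

theorem HasWeakImage.eLpNorm_smul_le (hw : ∀ i, ContDiff ℝ 1 (w i)) (hB : Continuous B)
    (hq : Continuous q) (hq1 : ∀ x, |q x| ≤ 1)
    (hest : ∀ φ : E → F, ContDiff ℝ ∞ φ → HasCompactSupport φ →
      eLpNorm (fun x => q x • φ x) 2 μ ≤ eLpNorm (fun x => firstOrder w c φ x + B x (φ x)) 2 μ)
    (hum : StronglyMeasurable u) (hu : MemLp u 2 μ) (huc : HasCompactSupport u)
    (hgm : StronglyMeasurable g) (hg : MemLp g 2 μ) (h : HasWeakImage μ w c u g) :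
    eLpNorm (fun x => q x • u x) 2 μ ≤ eLpNorm (fun x => g x + B x (u x)) 2 μ := by
  obtain ⟨η, hη⟩ := exists_isMollifier μ
  have hlim := ((((tendsto_const_nhds (x := eLpNorm (fun x => g x + B x (u x)) 2 μ)).add
    (h.tendsto_eLpNorm_firstOrder_mollify_sub hη hw hum hu huc)).add
    (tendsto_eLpNorm_mollify_sub hη hgm hg)).add
    (tendsto_eLpNorm_clm_mollify_sub hη hum hu huc hB)).add (tendsto_eLpNorm_mollify_sub hη hum hu)
  simp only [add_zero] at hlim
  refine ge_of_tendsto hlim ?_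
  filter_upwards [self_mem_nhdsWithin] with ε hε
  have hv := hη.contDiff_mollify hε (hu.locallyIntegrable one_le_two)
  have hvg := hη.contDiff_mollify hε (hg.locallyIntegrable one_le_two)
  have hvc := hη.hasCompactSupport_mollify (μ := μ) hε huc
  set v := mollify μ η ε u
  set vg := mollify μ η ε g
  have hvm : AEStronglyMeasurable v μ := hv.continuous.aestronglyMeasurable
  have hvgm : AEStronglyMeasurable vg μ := hvg.continuous.aestronglyMeasurable
  have hPm : AEStronglyMeasurable (firstOrder w c v) μ :=
    (continuous_firstOrder hw hv).aestronglyMeasurable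
  have hum' := hu.aestronglyMeasurable
  have hgm' := hg.aestronglyMeasurable
  have hPv : eLpNorm (fun x => firstOrder w c v x + B x (v x)) 2 μ ≤
      eLpNorm (fun x => g x + B x (u x)) 2 μ + eLpNorm (fun x => firstOrder w c v x - vg x) 2 μ
        + eLpNorm (fun x => vg x - g x) 2 μ + eLpNorm (fun x => B x (v x - u x)) 2 μ := by
    calc eLpNorm (fun x => firstOrder w c v x + B x (v x)) 2 μ
        = eLpNorm (fun x => (g x + B x (u x)) + (firstOrder w c v x - vg x) + (vg x - g x)
            + B x (v x - u x)) 2 μ := by congr 1; ext x; rw [map_sub]; abel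
      _ ≤ _ := (eLpNorm_add_le (by fun_prop) (by fun_prop) one_le_two).trans
        (add_le_add_left ((eLpNorm_add_le (by fun_prop) (by fun_prop) one_le_two).trans
          (add_le_add_left (eLpNorm_add_le (by fun_prop) (by fun_prop) one_le_two) _)) _)
  exact (eLpNorm_smul_le_add hq hq1 hvm hum').trans (add_le_add_left ((hest v hv hvc).trans hPv) _)

theorem HasWeakImage.eLpNorm_smul_smul_le (hw : ∀ i, ContDiff ℝ 1 (w i)) (hB : Continuous B)
    (hq : Continuous q) (hq1 : ∀ x, |q x| ≤ 1)
    (hest : ∀ φ : E → F, ContDiff ℝ ∞ φ → HasCompactSupport φ →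
      eLpNorm (fun x => q x • φ x) 2 μ ≤ eLpNorm (fun x => firstOrder w c φ x + B x (φ x)) 2 μ)
    {χ : E → ℝ} (hχ : ContDiff ℝ ∞ χ) (hχc : HasCompactSupport χ) {δ : ℝ}
    (hχδ : ∀ x s, ‖∑ i, fderiv ℝ χ x (w i x) • c i s‖ ≤ δ * ‖s‖)
    (hum : StronglyMeasurable u) (hu : MemLp u 2 μ)
    (h : HasWeakImage μ w c u fun x => -B x (u x)) :
    eLpNorm (fun x => q x • χ x • u x) 2 μ ≤ ENNReal.ofReal δ * eLpNorm u 2 μ := by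
  have hloc := hu.locallyIntegrable one_le_two
  let A (x : E) : F →L[ℝ] F := -(χ x • B x) + ∑ i, fderiv ℝ χ x (w i x) • c i
  have hA : Continuous A := (hχ.continuous.smul hB).neg.add <|
    continuous_finsetSum _ fun i _ => ((hχ.continuous_fderiv (by simp)).clm_apply
      (hw i).continuous).smul continuous_const
  have hAc : HasCompactSupport A := .intro hχc fun x hx => by
    simp [A, image_eq_zero_of_notMem_tsupport hx,
      image_eq_zero_of_notMem_tsupport fun h => hx (tsupport_fderiv_subset ℝ h)]
  have hcut : HasWeakImage μ w c (fun x => χ x • u x) fun x => A x (u x) := by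
    simpa [A] using h.smul hw hloc (locallyIntegrable_clm_apply hB.neg hloc) hχ
  have hAm : StronglyMeasurable fun x => A x (u x) :=
    isBoundedBilinearMap_apply.continuous.comp_stronglyMeasurable
      (hA.stronglyMeasurable.prodMk hum)
  have hχm : StronglyMeasurable fun x => χ x • u x :=
    hχ.continuous.stronglyMeasurable.smul hum
  have hχu : MemLp (fun x => χ x • u x) 2 μ := memLp_clm_apply
    (A := fun x => χ x • ContinuousLinearMap.id ℝ F) (hχ.continuous.smul continuous_const)
    hχc.smul_right hu
  refine (hcut.eLpNorm_smul_le hw hB hq hq1 hest hχm hχu hχc.smul_right hAm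
    (memLp_clm_apply hA hAc hu)).trans
    (eLpNorm_le_mul_eLpNorm_of_ae_le_mul (.of_forall fun x => ?_) 2)
  simpa [A] using hχδ x (u x)

theorem HasWeakImage.ae_eq_zero (hw : ∀ i, ContDiff ℝ 1 (w i)) (hB : Continuous B)
    (hq : Continuous q) (hq0 : ∀ x, q x ≠ 0) (hq1 : ∀ x, |q x| ≤ 1)
    (hest : ∀ φ : E → F, ContDiff ℝ ∞ φ → HasCompactSupport φ →
      eLpNorm (fun x => q x • φ x) 2 μ ≤ eLpNorm (fun x => firstOrder w c φ x + B x (φ x)) 2 μ)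
    {χ : ℕ → E → ℝ} (hχ : ∀ n, ContDiff ℝ ∞ (χ n)) (hχc : ∀ n, HasCompactSupport (χ n))
    (hχ1 : ∀ x, Tendsto (χ · x) atTop (𝓝 1)) {δ : ℕ → ℝ} (hδ : Tendsto δ atTop (𝓝 0))
    (hχδ : ∀ n x s, ‖∑ i, fderiv ℝ (χ n) x (w i x) • c i s‖ ≤ δ n * ‖s‖)
    (hum : StronglyMeasurable u) (hu : MemLp u 2 μ)
    (h : HasWeakImage μ w c u fun x => -B x (u x)) : u =ᵐ[μ] 0 := by
  have hbound (n : ℕ) : eLpNorm (fun x => q x • χ n x • u x) 2 μ ≤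
      ENNReal.ofReal (δ n) * eLpNorm u 2 μ :=
    h.eLpNorm_smul_smul_le hw hB hq hq1 hest (hχ n) (hχc n) (hχδ n) hum hu
  have hum' := hu.aestronglyMeasurable
  have hzero : eLpNorm (fun x => q x • u x) 2 μ = 0 := by
    have hlim : Tendsto (fun n => ENNReal.ofReal (δ n) * eLpNorm u 2 μ) atTop (𝓝 0) := by
      simpa using ENNReal.Tendsto.mul_const (ENNReal.tendsto_ofReal hδ) (.inr hu.eLpNorm_ne_top)
    refine le_antisymm ?_ zero_le
    refine (Lp.eLpNorm_lim_le_liminf_eLpNorm (f := fun n x => q x • χ n x • u x)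
      (fun n => hq.aestronglyMeasurable.smul ((hχ n).continuous.aestronglyMeasurable.smul hum')) _
      (.of_forall fun x => ?_)).trans ?_
    · simpa using (((hχ1 x).smul_const (u x)).const_smul (q x))
    · exact (liminf_le_liminf (.of_forall hbound)).trans hlim.liminf_eq.le
  rw [eLpNorm_eq_zero_iff (by fun_prop) two_ne_zero] at hzero
  exact hzero.mono fun x hx => (smul_eq_zero_iff_right (hq0 x)).1 hx

end Vanishing

/-! ### Clifford systems -/

section Clifford

variable {ι F : Type*} [NormedAddCommGroup F] [InnerProductSpace ℝ F] {c : ι → F →L[ℝ] F}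

/-- Skew-adjoint operators satisfying the Clifford relations `cᵢcⱼ + cⱼcᵢ = -2δᵢⱼ`. -/
structure IsCliffordSystem [DecidableEq ι] (c : ι → F →L[ℝ] F) : Prop where
  inner_left : ∀ i u v, inner ℝ (c i u) v = -inner ℝ u (c i v)
  anticomm : ∀ i j u, c i (c j u) + c j (c i u) = if i = j then (-2 : ℝ) • u else 0

/-- The action of the bivector `eᵢ ∧ eⱼ`, that is `cᵢcⱼ` for `i ≠ j` and `0` for `i = j`. -/
def bivector [DecidableEq ι] (c : ι → F →L[ℝ] F) (i j : ι) : F →L[ℝ] F :=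
  c i ∘L c j + if i = j then .id ℝ F else 0

variable [DecidableEq ι]

theorem bivector_apply (i j : ι) (u : F) :
    bivector c i j u = c i (c j u) + if i = j then u else 0 := by
  by_cases hij : i = j <;> simp [bivector, hij]

namespace IsCliffordSystem

theorem apply_self (hc : IsCliffordSystem c) (i : ι) (u : F) : c i (c i u) = -u := by
  have h := hc.anticomm i i u
  rw [if_pos rfl, ← two_smul ℝ, neg_smul, ← smul_neg] at h
  exact smul_right_injective F (two_ne_zero (α := ℝ)) h

theorem bivector_swap (hc : IsCliffordSystem c) (i j : ι) (u : F) :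
    bivector c j i u = -bivector c i j u := by
  have h := hc.anticomm i j u
  rw [bivector_apply, bivector_apply, ← add_eq_zero_iff_eq_neg]
  by_cases hij : i = j
  · subst hij
    simp [hc.apply_self]
  · rw [if_neg hij] at h
    simp [hij, Ne.symm hij, add_comm (c j _), h]

theorem inner_bivector_left (hc : IsCliffordSystem c) (i j : ι) (u v : F) :
    inner ℝ (bivector c i j u) v = -inner ℝ u (bivector c i j v) := by
  rw [← inner_neg_right, ← hc.bivector_swap, bivector_apply, bivector_apply, inner_add_left,
    inner_add_right, hc.inner_left, hc.inner_left, neg_neg]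
  by_cases hij : i = j <;> simp [hij, Ne.symm]

variable [Fintype ι]

theorem sum_inner_bivector (hc : IsCliffordSystem c) (X Y : ι → F) :
    ∑ i, ∑ j, inner ℝ (X i) (bivector c i j (Y j)) =
      ∑ i, inner ℝ (X i) (Y i) - inner ℝ (∑ i, c i (X i)) (∑ i, c i (Y i)) := by
  have h (i j : ι) : inner ℝ (X i) (bivector c i j (Y j)) =
      (if i = j then inner ℝ (X i) (Y j) else 0) - inner ℝ (c i (X i)) (c j (Y j)) := by
    rw [bivector_apply, inner_add_right, hc.inner_left]
    by_cases hij : i = j <;> simp [hij, add_comm]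
  rw [sum_inner]
  simp only [h, Finset.sum_sub_distrib, Finset.sum_ite_eq, Finset.mem_univ, if_true, inner_sum]

theorem norm_sum_smul_sq (hc : IsCliffordSystem c) (t : ι → ℝ) (u : F) :
    ‖∑ i, t i • c i u‖ ^ 2 = (∑ i, t i ^ 2) * ‖u‖ ^ 2 := by
  have hzero (i j : ι) : inner ℝ u (bivector c i j u) = 0 := by
    linarith [hc.inner_bivector_left i j u u, real_inner_comm u (bivector c i j u)]
  have h := hc.sum_inner_bivector (fun i => t i • u) (fun i => t i • u)
  simp only [map_smul, real_inner_smul_left, real_inner_smul_right, hzero, mul_zero,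
    Finset.sum_const_zero, real_inner_self_eq_norm_sq, norm_smul, mul_pow, Real.norm_eq_abs,
    sq_abs] at h
  rw [Finset.sum_mul]
  linarith [h]

theorem isTotalDivergence_lichnerowicz {E : Type*} [NormedAddCommGroup E] [NormedSpace ℝ E]
    [FiniteDimensional ℝ E] (hc : IsCliffordSystem c) {φ : E → F} (hφ : ContDiff ℝ 2 φ)
    (hφc : HasCompactSupport φ) {w : ι → E → E} (hw : ∀ i, ContDiff ℝ 1 (w i)) :
    IsTotalDivergence fun x => ∑ i, ‖fderiv ℝ φ x (w i x)‖ ^ 2 - ‖firstOrder w c φ x‖ ^ 2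
      + (1 / 2) * ∑ i, ∑ j, inner ℝ (φ x)
        (bivector c i j (fderiv ℝ φ x (divBracket (w i) (w j) x))) := by
  have h := (IsTotalDivergence.sum Finset.univ fun i _ => .sum Finset.univ fun j _ =>
    isTotalDivergence_nullForm (hc.inner_bivector_left i j) hφ hφc (hw i) (hw j)).const_mul (1 / 2)
  convert h using 2 with x
  simp only [Finset.sum_add_distrib, ← Finset.mul_sum, firstOrder,
    hc.sum_inner_bivector (fun i => fderiv ℝ φ x (w i x)), real_inner_self_eq_norm_sq]
  ring

end IsCliffordSystem

end Clifford

/-! ### The Taub-NUT frame -/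

section Frame

theorem inner_self_hopf (x : E4) : inner ℝ x (hopf x) = 0 := by
  simp only [hopf, PiLp.inner_apply, Fin.sum_univ_four]
  simp
  ring

/-- The generator of the Hopf circle action as a continuous linear map. -/
def hopfCLM : E4 →L[ℝ] E4 :=
  LinearMap.toContinuousLinearMap
    { toFun := hopf
      map_add' := fun x y => by ext i; fin_cases i <;> simp [hopf] <;> ring
      map_smul' := fun c x => by ext i; fin_cases i <;> simp [hopf] }

/-- The matrix of the generator of the Hopf circle action. -/
def hopfMatrix : Matrix (Fin 4) (Fin 4) ℝ :=
  !![0, -1, 0, 0; 1, 0, 0, 0; 0, 0, 0, -1; 0, 0, 1, 0]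

theorem hopfMatrix_swap (i j : Fin 4) : hopfMatrix j i = -hopfMatrix i j := by
  fin_cases i <;> fin_cases j <;> simp [hopfMatrix]

theorem hopf_add_smul_hopf (u x : E4) (t : ℝ) : hopf (u + t • hopf x) = hopf u - t • x := by
  ext i
  fin_cases i <;> simp [hopf] <;> ring

theorem hopf_single_apply (i j : Fin 4) :
    hopf (EuclideanSpace.single i 1) j = hopfMatrix j i := by
  fin_cases i <;> fin_cases j <;> simp [hopf, hopfMatrix]

theorem inner_hopf_hopf (x y : E4) : inner ℝ (hopf x) (hopf y) = inner ℝ x y := by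
  simp only [hopf, PiLp.inner_apply, Fin.sum_univ_four]
  simp
  ring

/-- The vector fields `∂ᵢ + κ hᵢ h`, with `h` the Hopf field; for `κ = b / a` this is the
Taub-NUT frame without its conformal factor. -/
def flatFrame (κ : ℝ) (i : Fin 4) (x : E4) : E4 :=
  EuclideanSpace.single i 1 + (κ * hopf x i) • hopf x

/-- The function `κ / (1 + κ |x|²)`; for `κ = b / a` it is `b / (a + b |x|²)`, minus the logarithmic
derivative of the conformal factor of the Taub-NUT frame. -/
def radialWeight (κ : ℝ) (x : E4) : ℝ := κ / (1 + κ * ‖x‖ ^ 2)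

/-- The coframe dual to `flatFrame`. -/
def flatCoframe (κ : ℝ) (i : Fin 4) (x : E4) : E4 →L[ℝ] ℝ :=
  EuclideanSpace.proj i - (radialWeight κ x * hopf x i) • innerSL ℝ (hopf x)

variable {κ : ℝ}

theorem contDiff_flatFrame (κ : ℝ) (i : Fin 4) : ContDiff ℝ ∞ (flatFrame κ i) :=
  contDiff_const.add ((contDiff_const.mul (contDiff_euclidean.1 hopf_smooth i)).smul hopf_smooth)

theorem radialWeight_mul (hκ : 0 ≤ κ) (x : E4) : radialWeight κ x * (1 + κ * ‖x‖ ^ 2) = κ :=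
  div_mul_cancel₀ _ (by positivity)

theorem inner_flatFrame (κ : ℝ) (x : E4) (i : Fin 4) : inner ℝ x (flatFrame κ i x) = x i := by
  rw [flatFrame, inner_add_right, inner_smul_right, inner_self_hopf,
    EuclideanSpace.inner_single_right]
  simp

theorem flatCoframe_apply (κ : ℝ) (i : Fin 4) (x u : E4) :
    flatCoframe κ i x u = u i - radialWeight κ x * hopf x i * inner ℝ (hopf x) u := rfl

theorem sum_flatCoframe_smul_flatFrame (hκ : 0 ≤ κ) (x u : E4) :
    ∑ k, flatCoframe κ k x u • flatFrame κ k x = u := by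
  have hinner : inner ℝ (hopf x) u =
      hopf x 0 * u 0 + hopf x 1 * u 1 + hopf x 2 * u 2 + hopf x 3 * u 3 := by
    simp [PiLp.inner_apply, Fin.sum_univ_four, mul_comm]
  have hnorm : ‖x‖ ^ 2 = hopf x 0 ^ 2 + hopf x 1 ^ 2 + hopf x 2 ^ 2 + hopf x 3 ^ 2 := by
    rw [← norm_sq_eq, ← real_inner_self_eq_norm_sq, ← real_inner_self_eq_norm_sq, inner_hopf_hopf]
  have hβ := radialWeight_mul hκ x
  simp only [flatCoframe_apply, flatFrame]
  generalize hopf x = h at *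
  rw [hnorm] at hβ
  rw [hinner]
  set t := h 0 * u 0 + h 1 * u 1 + h 2 * u 2 + h 3 * u 3 with ht
  ext l
  fin_cases l <;> simp [Fin.sum_univ_four]
  · linear_combination -t * h 0 * hβ - κ * h 0 * ht
  · linear_combination -t * h 1 * hβ - κ * h 1 * ht
  · linear_combination -t * h 2 * hβ - κ * h 2 * ht
  · linear_combination -t * h 3 * hβ - κ * h 3 * ht

theorem flatCoframe_flatFrame (hκ : 0 ≤ κ) (x : E4) (i j : Fin 4) :
    flatCoframe κ i x (flatFrame κ j x) = if i = j then 1 else 0 := by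
  have h : inner ℝ (hopf x) (flatFrame κ j x) = hopf x j * (1 + κ * ‖x‖ ^ 2) := by
    rw [flatFrame, inner_add_right, inner_smul_right, inner_hopf_hopf, real_inner_self_eq_norm_sq,
      EuclideanSpace.inner_single_right]
    simp
    ring
  rw [flatCoframe_apply, h, flatFrame]
  simp only [PiLp.add_apply, PiLp.smul_apply, PiLp.single_apply, smul_eq_mul]
  linear_combination -hopf x i * hopf x j * radialWeight_mul hκ x

theorem hasFDerivAt_flatFrame (κ : ℝ) (i : Fin 4) (x : E4) :
    HasFDerivAt (flatFrame κ i) ((κ * hopf x i) • hopfCLM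
      + (κ • ((EuclideanSpace.proj i : E4 →L[ℝ] ℝ) ∘L hopfCLM)).smulRight (hopf x)) x :=
  ((((EuclideanSpace.proj i : E4 →L[ℝ] ℝ) ∘L hopfCLM).hasFDerivAt.const_mul κ).smul
    hopfCLM.hasFDerivAt).const_add _

theorem fderiv_flatFrame_apply (κ : ℝ) (i : Fin 4) (x v : E4) :
    fderiv ℝ (flatFrame κ i) x v = (κ * hopf x i) • hopf v + (κ * hopf v i) • hopf x := by
  rw [(hasFDerivAt_flatFrame κ i x).fderiv]
  rfl

theorem divergence_flatFrame (κ : ℝ) (i : Fin 4) (x : E4) :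
    divergence (flatFrame κ i) x = -κ * x i := by
  rw [divergence, LinearMap.trace_eq_sum_inner _ (EuclideanSpace.basisFun (Fin 4) ℝ)]
  simp only [ContinuousLinearMap.coe_coe, fderiv_flatFrame_apply, EuclideanSpace.basisFun_apply,
    EuclideanSpace.inner_single_left, PiLp.add_apply, PiLp.smul_apply, hopf_single_apply]
  fin_cases i <;> simp [Fin.sum_univ_four, hopf, hopfMatrix]

theorem lieBracket_flatFrame (κ : ℝ) (i j : Fin 4) (x : E4) :
    VectorField.lieBracket ℝ (flatFrame κ i) (flatFrame κ j) x =
      (κ * hopf x j) • hopf (EuclideanSpace.single i 1)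
      - (κ * hopf x i) • hopf (EuclideanSpace.single j 1)
      + (κ * (-2 * hopfMatrix i j + κ * (hopf x j * x i - hopf x i * x j))) • hopf x := by
  rw [VectorField.lieBracket, fderiv_flatFrame_apply, fderiv_flatFrame_apply, flatFrame, flatFrame,
    hopf_add_smul_hopf, hopf_add_smul_hopf]
  simp only [PiLp.sub_apply, PiLp.smul_apply, smul_eq_mul, hopf_single_apply, hopfMatrix_swap i j]
  module

theorem flatCoframe_hopf (hκ : 0 ≤ κ) (k : Fin 4) (x : E4) :
    κ * flatCoframe κ k x (hopf x) = radialWeight κ x * hopf x k := by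
  rw [flatCoframe_apply, inner_hopf_hopf, real_inner_self_eq_norm_sq]
  linear_combination -hopf x k * radialWeight_mul hκ x

theorem flatCoframe_hopf_single (κ : ℝ) (k i : Fin 4) (x : E4) :
    flatCoframe κ k x (hopf (EuclideanSpace.single i 1)) =
      hopfMatrix k i - radialWeight κ x * hopf x k * x i := by
  rw [flatCoframe_apply, inner_hopf_hopf, hopf_single_apply, EuclideanSpace.inner_single_right]
  simp

theorem flatCoframe_lieBracket (hκ : 0 ≤ κ) (i j k : Fin 4) (x : E4) :
    flatCoframe κ k x (VectorField.lieBracket ℝ (flatFrame κ i) (flatFrame κ j) x) =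
      κ * (hopf x j * hopfMatrix k i - hopf x i * hopfMatrix k j)
      - 2 * radialWeight κ x * hopfMatrix i j * hopf x k := by
  rw [lieBracket_flatFrame]
  simp only [map_add, map_sub, map_smul, smul_eq_mul, flatCoframe_hopf_single]
  linear_combination
    (-2 * hopfMatrix i j + κ * (hopf x j * x i - hopf x i * x j)) * flatCoframe_hopf hκ k x

theorem flatCoframe_divBracket (hκ : 0 ≤ κ) (i j k : Fin 4) (x : E4) :
    flatCoframe κ k x (divBracket (flatFrame κ i) (flatFrame κ j) x) =
      κ * (hopf x j * hopfMatrix k i - hopf x i * hopfMatrix k j)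
      - 2 * radialWeight κ x * hopfMatrix i j * hopf x k
      + κ * ((if k = i then x j else 0) - (if k = j then x i else 0)) := by
  rw [divBracket, map_sub, map_add, flatCoframe_lieBracket hκ, map_smul, map_smul,
    flatCoframe_flatFrame hκ, flatCoframe_flatFrame hκ, divergence_flatFrame, divergence_flatFrame]
  simp only [smul_eq_mul, mul_ite, mul_one, mul_zero]
  split_ifs <;> ring

/-- The conformal factor of the Taub-NUT frame. -/
def frameScale (a b : ℝ) (x : E4) : ℝ := 1 / (2 * √(a + b * ‖x‖ ^ 2))

variable {a b : ℝ} (ha : 0 < a) (hb : 0 < b)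

theorem taubNUTFrame_vec (i : Fin 4) : (taubNUTFrame a b ha hb).vec i =
    fun x => frameScale a b x • flatFrame (b / a) i x := rfl

include ha hb

theorem frameScale_pos (x : E4) : 0 < frameScale a b x := by
  rw [frameScale]
  positivity

theorem radialWeight_div (x : E4) : radialWeight (b / a) x = b / (a + b * ‖x‖ ^ 2) := by
  rw [radialWeight]
  field_simp

theorem hasFDerivAt_frameScale (x : E4) : HasFDerivAt (frameScale a b)
    (-(frameScale a b x * radialWeight (b / a) x) • innerSL ℝ x) x := by
  have hm : 0 < a + b * ‖x‖ ^ 2 := by positivity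
  have hs : √(a + b * ‖x‖ ^ 2) ^ 2 = a + b * ‖x‖ ^ 2 := Real.sq_sqrt hm.le
  have h : HasDerivAt (fun t => 1 / (2 * √(a + b * t)))
      (-(frameScale a b x * radialWeight (b / a) x) / 2) (‖x‖ ^ 2) := by
    have h := ((((hasDerivAt_id (‖x‖ ^ 2)).const_mul b).const_add a).sqrt hm.ne').const_mul 2
    simp only [one_div]
    refine (h.inv (by simp only [id]; positivity)).congr_deriv ?_
    rw [frameScale, radialWeight_div ha hb]
    simp only [id]
    field_simp
    rw [hs]
  refine (h.comp_hasFDerivAt x (hasFDerivAt_norm_sq x)).congr_fderiv ?_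
  rw [smul_smul]
  ring_nf

theorem inner_taubNUTFrame (x u : E4) (k : Fin 4) :
    (taubNUT a b ha hb).inner x u ((taubNUTFrame a b ha hb).vec k x) =
      (frameScale a b x)⁻¹ * flatCoframe (b / a) k x u := by
  have hl := (frameScale_pos ha hb x).ne'
  have hu : u = ∑ j, ((frameScale a b x)⁻¹ * flatCoframe (b / a) j x u) •
      (taubNUTFrame a b ha hb).vec j x := by
    conv_lhs => rw [← sum_flatCoframe_smul_flatFrame (by positivity : 0 ≤ b / a) x u]
    refine Finset.sum_congr rfl fun j _ => ?_
    rw [taubNUTFrame_vec, smul_smul, mul_right_comm, inv_mul_cancel₀ hl, one_mul]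
  conv_lhs => rw [hu]
  have hsum (t : Fin 4 → ℝ) (v : Fin 4 → E4) (w : E4) : (taubNUT a b ha hb).inner x
      (∑ j, t j • v j) w = ∑ j, t j * (taubNUT a b ha hb).inner x (v j) w := by
    simp only [RiemannianMetric.inner, Fin.sum_univ_four, PiLp.add_apply, PiLp.smul_apply,
      smul_eq_mul]
    ring
  simp [hsum, (taubNUTFrame a b ha hb).orthonormal]

theorem lieBracket_taubNUTFrame (i j : Fin 4) (x : E4) :
    VectorField.lieBracket ℝ ((taubNUTFrame a b ha hb).vec i) ((taubNUTFrame a b ha hb).vec j) x =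
      frameScale a b x ^ 2 •
        (VectorField.lieBracket ℝ (flatFrame (b / a) i) (flatFrame (b / a) j) x -
          radialWeight (b / a) x •
            (x i • flatFrame (b / a) j x - x j • flatFrame (b / a) i x)) := by
  have hl := hasFDerivAt_frameScale ha hb x
  have hf (i : Fin 4) := (hasFDerivAt_flatFrame (b / a) i x).differentiableAt
  have hderiv (i : Fin 4) : fderiv ℝ (frameScale a b) x (flatFrame (b / a) i x) =
      -(frameScale a b x * radialWeight (b / a) x) * x i := by
    rw [hl.fderiv, _root_.smul_apply, innerSL_apply_apply, inner_flatFrame, smul_eq_mul]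
  rw [taubNUTFrame_vec, taubNUTFrame_vec,
    VectorField.lieBracket_smul_left hl.differentiableAt (hf i),
    VectorField.lieBracket_smul_right hl.differentiableAt (hf j), map_smul, hderiv, hderiv]
  simp only [smul_eq_mul]
  module

/-- The coefficients `Γᵢⱼₖ` of the Levi-Civita connection of the Taub-NUT metric in its
orthonormal frame, divided by `frameScale`. -/
def connectionCoeff (κ : ℝ) (i j k : Fin 4) (x : E4) : ℝ :=
  radialWeight κ x * (hopf x i * hopfMatrix j k + hopf x j * hopfMatrix i k
      - hopf x k * hopfMatrix i j)
    + κ * hopf x i * hopfMatrix j k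
    - radialWeight κ x * ((if i = j then x k else 0) - (if i = k then x j else 0))

theorem christoffel_taubNUTFrame (i j k : Fin 4) (x : E4) :
    (taubNUTFrame a b ha hb).christoffel i j k x =
      frameScale a b x * connectionCoeff (b / a) i j k x := by
  have hκ : 0 ≤ b / a := by positivity
  have hl := (frameScale_pos ha hb x).ne'
  have hbracket (i j k : Fin 4) : (taubNUT a b ha hb).inner x
      (VectorField.lieBracket ℝ ((taubNUTFrame a b ha hb).vec i)
        ((taubNUTFrame a b ha hb).vec j) x) ((taubNUTFrame a b ha hb).vec k x) =
      frameScale a b x * (b / a * (hopf x j * hopfMatrix k i - hopf x i * hopfMatrix k j)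
        - 2 * radialWeight (b / a) x * hopfMatrix i j * hopf x k
        - radialWeight (b / a) x * ((if k = j then x i else 0) - (if k = i then x j else 0))) := by
    rw [inner_taubNUTFrame, lieBracket_taubNUTFrame, map_smul, map_sub, map_smul, map_sub,
      map_smul, map_smul, flatCoframe_lieBracket hκ, flatCoframe_flatFrame hκ,
      flatCoframe_flatFrame hκ]
    simp only [smul_eq_mul, mul_ite, mul_one, mul_zero]
    field_simp
  rw [OrthonormalFrame.christoffel, hbracket, hbracket, hbracket, connectionCoeff,
    hopfMatrix_swap k j, hopfMatrix_swap k i, hopfMatrix_swap j i]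
  simp only [eq_comm (a := k), eq_comm (a := j) (b := i)]
  ring

end Frame

/-! ### Spinors -/

section Spinors

theorem real_inner_eq_re (u v : Spinor) : inner ℝ u v = (inner ℂ u v).re := by
  simp [PiLp.inner_apply, Complex.inner, mul_comm]

theorem inner_cliff_left (i : Fin 4) (u v : Spinor) :
    inner ℂ (cliff i u) v = -inner ℂ u (cliff i v) := by
  have h : star (cliff i) = -cliff i := by
    rw [cliff, ← map_star, Matrix.star_eq_conjTranspose, gamma_skew, map_neg]
  rw [← inner_neg_right, ← neg_apply, ← h, ContinuousLinearMap.star_eq_adjoint,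
    ContinuousLinearMap.adjoint_inner_right]

theorem cliff_anticomm (i j : Fin 4) (u : Spinor) :
    cliff i (cliff j u) + cliff j (cliff i u) = if i = j then (-2 : ℝ) • u else 0 := by
  have h := congrArg (fun A => Matrix.toEuclideanCLM (𝕜 := ℂ) A u) (gamma_clifford i j)
  rw [map_add, map_mul, map_mul, map_smul, map_one] at h
  refine h.trans ?_
  split_ifs <;> simp [← Complex.coe_smul]

/-- Clifford multiplication by the `i`-th frame vector, as a real linear map. -/
def realCliff (i : Fin 4) : Spinor →L[ℝ] Spinor := (cliff i).restrictScalars ℝ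

theorem realCliff_apply (i : Fin 4) (s : Spinor) : realCliff i s = cliff i s := rfl

theorem isCliffordSystem_realCliff : IsCliffordSystem realCliff where
  inner_left i u v := by
    rw [real_inner_eq_re, real_inner_eq_re, realCliff_apply, inner_cliff_left, Complex.neg_re,
      realCliff_apply]
  anticomm := cliff_anticomm

theorem cliff_apply (i : Fin 4) (s : Spinor) (k : Fin 4) : cliff i s k = (gamma i *ᵥ s.ofLp) k := by
  rw [cliff, Matrix.ofLp_toEuclideanCLM]

theorem cliff_zero (s : Spinor) : cliff 0 s = !₂[-s 2, -s 3, s 0, s 1] := by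
  ext k
  rw [cliff_apply]
  fin_cases k <;> simp [gamma, Matrix.mulVec, dotProduct, Fin.sum_univ_four]

theorem cliff_one (s : Spinor) :
    cliff 1 s = !₂[Complex.I * s 3, Complex.I * s 2, Complex.I * s 1, Complex.I * s 0] := by
  ext k
  rw [cliff_apply]
  fin_cases k <;> simp [gamma, Matrix.mulVec, dotProduct, Fin.sum_univ_four]

theorem cliff_two (s : Spinor) : cliff 2 s = !₂[s 3, -s 2, s 1, -s 0] := by
  ext k
  rw [cliff_apply]
  fin_cases k <;> simp [gamma, Matrix.mulVec, dotProduct, Fin.sum_univ_four]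

theorem cliff_three (s : Spinor) :
    cliff 3 s = !₂[Complex.I * s 2, -(Complex.I * s 3), Complex.I * s 0, -(Complex.I * s 1)] := by
  ext k
  rw [cliff_apply]
  fin_cases k <;> simp [gamma, Matrix.mulVec, dotProduct, Fin.sum_univ_four]

/-- The orthogonal projection onto the half-spinors on which `chirality` is `-1`. -/
def negProj : Spinor →L[ℝ] Spinor :=
  (1 / 2 : ℝ) • (.id ℝ Spinor - chirality.restrictScalars ℝ)

theorem negProj_apply (s : Spinor) : negProj s = !₂[s 0, s 1, 0, 0] := by
  have h : negProj s = (1 / 2 : ℝ) • (s - cliff 0 (cliff 1 (cliff 2 (cliff 3 s)))) := rfl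
  rw [h, cliff_zero, cliff_one, cliff_two, cliff_three]
  ext k
  fin_cases k <;> simp [← mul_assoc] <;> ring

theorem inner_negProj (u v : Spinor) : inner ℝ u (negProj v) = inner ℝ (negProj u) (negProj v) := by
  simp [negProj_apply, PiLp.inner_apply, Fin.sum_univ_four]

theorem inner_negProj_left (u v : Spinor) : inner ℂ (negProj u) v = inner ℂ u (negProj v) := by
  simp [negProj_apply, PiLp.inner_apply, Fin.sum_univ_four]

theorem negProj_cliff (i : Fin 4) (s : Spinor) :
    negProj (cliff i s) = cliff i s - cliff i (negProj s) := by
  fin_cases i <;> ext c <;> fin_cases c <;>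
    simp [negProj_apply, cliff_zero, cliff_one, cliff_two, cliff_three]

end Spinors

section SpinConnection

variable {κ : ℝ}

/-- The zeroth-order part of the spin connection of the Taub-NUT metric in its orthonormal frame,
divided by `frameScale`. -/
def spinForm (κ : ℝ) (x : E4) (i : Fin 4) (s : Spinor) : Spinor :=
  (1 / 4 : ℝ) • ∑ j, ∑ k, connectionCoeff κ i j k x • cliff j (cliff k s)

set_option maxHeartbeats 1600000 in
-- sixteen Clifford products in four components
theorem spinForm_apply (κ : ℝ) (x : E4) (i : Fin 4) (s : Spinor) :
    spinForm κ x i s =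
      !₂[Complex.I * ↑((κ + radialWeight κ x) * hopf x i) * s 1
          - ↑(radialWeight κ x * ![-x 2, x 3, x 0, -x 1] i) * s 1
          - Complex.I * ↑(radialWeight κ x * ![-x 3, -x 2, x 1, x 0] i) * s 0,
        Complex.I * ↑((κ + radialWeight κ x) * hopf x i) * s 0
          + ↑(radialWeight κ x * ![-x 2, x 3, x 0, -x 1] i) * s 0
          + Complex.I * ↑(radialWeight κ x * ![-x 3, -x 2, x 1, x 0] i) * s 1,
        0, 0] := by
  rw [spinForm]
  simp only [Fin.sum_univ_four, cliff_zero, cliff_one, cliff_two, cliff_three, connectionCoeff]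
  generalize radialWeight κ x = β
  fin_cases i <;> ext c <;> fin_cases c <;> simp [hopfMatrix, hopf] <;> ring_nf <;>
    simp only [Complex.I_sq] <;> ring

theorem sum_smul_spinForm (κ : ℝ) (x : E4) (s : Spinor) : ∑ i, x i • spinForm κ x i s = 0 := by
  simp only [Fin.sum_univ_four, spinForm_apply]
  ext c
  fin_cases c <;> simp [hopf] <;> ring

theorem sum_cliff_spinForm (κ : ℝ) (x : E4) (s : Spinor) :
    ∑ i, cliff i (spinForm κ x i s) =
      (radialWeight κ x - κ) • ∑ i, x i • cliff i (negProj s) := by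
  simp only [Fin.sum_univ_four, spinForm_apply, negProj_apply, cliff_zero, cliff_one, cliff_two,
    cliff_three]
  generalize radialWeight κ x = β
  ext c
  fin_cases c <;> simp [hopf] <;> ring_nf <;> simp only [Complex.I_sq] <;> ring

theorem sum_norm_spinForm_sq (κ : ℝ) (x : E4) (s : Spinor) :
    ∑ i, ‖spinForm κ x i s‖ ^ 2 =
      ((κ + radialWeight κ x) ^ 2 + 2 * radialWeight κ x ^ 2) * ‖x‖ ^ 2 * ‖negProj s‖ ^ 2 := by
  simp only [spinForm_apply, negProj_apply, norm_sq_eq x, EuclideanSpace.norm_sq_eq,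
    ← Complex.normSq_eq_norm_sq, Complex.normSq_apply, Fin.sum_univ_four]
  simp [hopf]
  ring

set_option maxHeartbeats 1600000 in
-- sixteen matrix entries, each a sum over the sixteen bivectors
theorem weitzenboeck_spinForm (hκ : 0 ≤ κ) (x : E4) (k : Fin 4) (s : Spinor) :
    (1 / 2 : ℝ) • ∑ i, ∑ j, flatCoframe κ k x (divBracket (flatFrame κ i) (flatFrame κ j) x) •
        bivector realCliff i j s
      + (2 : ℝ) • (spinForm κ x k s + cliff k (∑ i, cliff i (spinForm κ x i s))) =
      (2 * (κ - radialWeight κ x) * x k) • negProj s := by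
  simp only [Fin.sum_univ_four, spinForm_apply, negProj_apply, bivector_apply,
    realCliff_apply, flatCoframe_divBracket hκ]
  generalize radialWeight κ x = β
  fin_cases k <;>
    simp only [Fin.zero_eta, Fin.mk_one, Fin.reduceFinMk, cliff_zero, cliff_one, cliff_two,
      cliff_three] <;>
    ext c <;> fin_cases c <;> simp [hopfMatrix, hopf] <;> ring_nf <;>
    simp only [Complex.I_sq, Complex.I_pow_three] <;> ring

/-- The covariant derivatives of the spin connection of the Taub-NUT metric along its orthonormal
frame, divided by `frameScale`. -/
def flatConnection (κ : ℝ) (i : Fin 4) (φ : E4 → Spinor) (x : E4) : Spinor :=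
  fderiv ℝ φ x (flatFrame κ i x) + spinForm κ x i (φ x)

/-- The Dirac operator of the Taub-NUT metric with `κ = b / a`, divided by `frameScale`. -/
def flatDirac (κ : ℝ) (φ : E4 → Spinor) (x : E4) : Spinor :=
  ∑ i, cliff i (flatConnection κ i φ x)

theorem dirac_taubNUTFrame {a b : ℝ} (ha : 0 < a) (hb : 0 < b) (φ : E4 → Spinor) (x : E4) :
    (taubNUTFrame a b ha hb).dirac φ x = frameScale a b x • flatDirac (b / a) φ x := by
  have h (i : Fin 4) : (taubNUTFrame a b ha hb).spinConnection i φ x =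
      frameScale a b x • flatConnection (b / a) i φ x := by
    simp only [OrthonormalFrame.spinConnection, flatConnection, taubNUTFrame_vec, map_smul,
      spinForm, christoffel_taubNUTFrame, smul_add, Finset.smul_sum, ← Complex.coe_smul, smul_smul]
    push_cast
    refine congrArg _ (Finset.sum_congr rfl fun j _ => Finset.sum_congr rfl fun k _ => ?_)
    rw [mul_left_comm]
  simp only [OrthonormalFrame.dirac, h, flatDirac, Finset.smul_sum]
  refine Finset.sum_congr rfl fun i _ => ?_
  exact map_smul (realCliff i) _ _

/-- The zeroth-order part of `flatDirac`. -/
def flatPotential (κ : ℝ) (x : E4) : Spinor →L[ℝ] Spinor :=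
  (radialWeight κ x - κ) • ∑ i, x i • realCliff i ∘L negProj

theorem flatPotential_apply (κ : ℝ) (x : E4) (s : Spinor) :
    flatPotential κ x s = (radialWeight κ x - κ) • ∑ i, x i • cliff i (negProj s) := by
  simp only [flatPotential, _root_.smul_apply, _root_.sum_apply, ContinuousLinearMap.comp_apply,
    realCliff_apply]

theorem contDiff_radialWeight (hκ : 0 ≤ κ) : ContDiff ℝ ∞ (radialWeight κ) :=
  contDiff_const.div (contDiff_const.add (contDiff_const.mul (contDiff_norm_sq ℝ)))
    fun x => by positivity

theorem continuous_flatPotential (hκ : 0 ≤ κ) : Continuous (flatPotential κ) := by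
  have h := (contDiff_radialWeight hκ).continuous
  unfold flatPotential
  fun_prop

theorem flatDirac_eq (κ : ℝ) (φ : E4 → Spinor) (x : E4) :
    flatDirac κ φ x = firstOrder (flatFrame κ) realCliff φ x + flatPotential κ x (φ x) := by
  rw [flatPotential_apply, ← sum_cliff_spinForm, flatDirac, firstOrder, ← Finset.sum_add_distrib]
  exact Finset.sum_congr rfl fun i _ => map_add _ _ _

theorem norm_sum_smul_cliff_sq (x : E4) (s : Spinor) :
    ‖∑ i, x i • cliff i s‖ ^ 2 = ‖x‖ ^ 2 * ‖s‖ ^ 2 := by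
  rw [EuclideanSpace.real_norm_sq_eq]
  exact isCliffordSystem_realCliff.norm_sum_smul_sq (fun i => x i) s

theorem fderiv_radialWeight (hκ : 0 ≤ κ) (x v : E4) :
    fderiv ℝ (radialWeight κ) x v =
      -2 * radialWeight κ x ^ 2 * inner ℝ x v := by
  have hρ : 1 + κ * ‖x‖ ^ 2 ≠ 0 := by positivity
  have h : HasDerivAt (fun t => κ / (1 + κ * t)) (-radialWeight κ x ^ 2) (‖x‖ ^ 2) := by
    have h := ((hasDerivAt_id (‖x‖ ^ 2)).const_mul κ).const_add 1
    refine ((hasDerivAt_const _ κ).div h hρ).congr_deriv ?_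
    rw [radialWeight, id]
    field_simp
    ring
  have hcomp : HasFDerivAt (radialWeight κ) _ x := HasDerivAt.comp_hasFDerivAt
    (f := fun y : E4 => ‖y‖ ^ 2) x h (hasFDerivAt_norm_sq x)
  rw [hcomp.fderiv]
  simp only [_root_.smul_apply, innerSL_apply_apply, smul_eq_mul]
  ring

theorem sum_smul_flatFrame (hκ : 0 ≤ κ) (x : E4) : ∑ i, x i • flatFrame κ i x = x := by
  conv_rhs => rw [← sum_flatCoframe_smul_flatFrame hκ x x]
  refine Finset.sum_congr rfl fun i _ => ?_
  rw [flatCoframe_apply, real_inner_comm, inner_self_hopf, mul_zero, sub_zero]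

/-- The first-order curvature term of `IsCliffordSystem.isTotalDivergence_lichnerowicz` and the
cross terms of the spin connection cancel up to a radial derivative. -/
theorem sum_inner_spinForm (hκ : 0 ≤ κ) (L : E4 →L[ℝ] Spinor) (x : E4) (s : Spinor) :
    2 * (∑ k, inner ℝ (spinForm κ x k s) (L (flatFrame κ k x))
        - inner ℝ (∑ k, cliff k (spinForm κ x k s)) (∑ k, cliff k (L (flatFrame κ k x)))) =
      (1 / 2) * ∑ i, ∑ j, inner ℝ s (bivector realCliff i j
          (L (divBracket (flatFrame κ i) (flatFrame κ j) x)))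
        + 2 * (κ - radialWeight κ x) * inner ℝ (negProj s) (L x) := by
  set S := ∑ k, cliff k (spinForm κ x k s) with hS
  set θ := fun i j k => flatCoframe κ k x (divBracket (flatFrame κ i) (flatFrame κ j) x) with hθ
  have hcurv : ∑ i, ∑ j, inner ℝ s (bivector realCliff i j
      (L (divBracket (flatFrame κ i) (flatFrame κ j) x))) =
      -∑ k, inner ℝ (∑ i, ∑ j, θ i j k • bivector realCliff i j s) (L (flatFrame κ k x)) := by
    have h (i j : Fin 4) : inner ℝ s (bivector realCliff i j
        (L (divBracket (flatFrame κ i) (flatFrame κ j) x))) =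
        -∑ k, θ i j k * inner ℝ (bivector realCliff i j s) (L (flatFrame κ k x)) := by
      conv_lhs => rw [← sum_flatCoframe_smul_flatFrame hκ x (divBracket _ _ x)]
      simp only [map_sum, map_smul, inner_sum, real_inner_smul_right, hθ,
        isCliffordSystem_realCliff.inner_bivector_left, mul_neg, Finset.sum_neg_distrib, neg_neg]
    simp only [h, sum_inner, real_inner_smul_left, Finset.sum_neg_distrib]
    rw [Finset.sum_congr rfl fun i _ => Finset.sum_comm, Finset.sum_comm]
  have hmix : inner ℝ S (∑ k, cliff k (L (flatFrame κ k x))) =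
      -∑ k, inner ℝ (cliff k S) (L (flatFrame κ k x)) := by
    rw [inner_sum, ← Finset.sum_neg_distrib]
    refine Finset.sum_congr rfl fun k _ => ?_
    rw [← realCliff_apply k S, isCliffordSystem_realCliff.inner_left, neg_neg, realCliff_apply]
  have hx : inner ℝ (negProj s) (L x) =
      ∑ k, x k * inner ℝ (negProj s) (L (flatFrame κ k x)) := by
    conv_lhs => rw [← sum_smul_flatFrame hκ x]
    simp only [map_sum, map_smul, inner_sum, real_inner_smul_right]
  have hk (k : Fin 4) := congrArg (inner ℝ · (L (flatFrame κ k x)))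
    (weitzenboeck_spinForm hκ x k s)
  simp only [inner_add_left, real_inner_smul_left, ← hS] at hk
  rw [hcurv, hmix, hx, sub_neg_eq_add, ← Finset.sum_add_distrib, Finset.mul_sum, Finset.mul_sum,
    mul_neg, Finset.mul_sum, neg_add_eq_sub, ← Finset.sum_sub_distrib]
  refine Finset.sum_congr rfl fun k _ => ?_
  linear_combination hk k

theorem sum_norm_spinForm_sq_sub (hκ : 0 ≤ κ) (x : E4) (s : Spinor) :
    ∑ i, ‖spinForm κ x i s‖ ^ 2 - ‖∑ i, cliff i (spinForm κ x i s)‖ ^ 2 =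
      (4 * (κ - radialWeight κ x) + 2 * radialWeight κ x ^ 2 * ‖x‖ ^ 2) * ‖negProj s‖ ^ 2 := by
  rw [sum_norm_spinForm_sq, sum_cliff_spinForm, norm_smul, mul_pow, norm_sum_smul_cliff_sq,
    Real.norm_eq_abs, sq_abs]
  linear_combination (4 * ‖negProj s‖ ^ 2) * radialWeight_mul hκ x

theorem isTotalDivergence_flatDirac (hκ : 0 ≤ κ) {φ : E4 → Spinor} (hφ : ContDiff ℝ 2 φ)
    (hφc : HasCompactSupport φ) : IsTotalDivergence fun x =>
      ∑ i, ‖flatConnection κ i φ x‖ ^ 2 - ‖flatDirac κ φ x‖ ^ 2 := by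
  have hlich := isCliffordSystem_realCliff.isTotalDivergence_lichnerowicz hφ hφc
    fun i => (contDiff_flatFrame κ i).of_le (by simp)
  have hrad := isTotalDivergence_radialForm (w := fun x => κ - radialWeight κ x)
    (φ := fun x => negProj (φ x)) (contDiff_const.sub ((contDiff_radialWeight hκ).of_le (by simp)))
    (negProj.contDiff.comp (hφ.of_le (by simp))) (hφc.comp_left (map_zero negProj))
  refine cast (congrArg IsTotalDivergence (funext fun x => ?_)) (hlich.add hrad)
  have hdN : fderiv ℝ (fun x => negProj (φ x)) x x = negProj (fderiv ℝ φ x x) := by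
    have h : HasFDerivAt (fun x => negProj (φ x)) _ x :=
      negProj.hasFDerivAt.comp x (hφ.differentiable (by simp) x).hasFDerivAt
    rw [h.fderiv, ContinuousLinearMap.comp_apply]
  have hdw : fderiv ℝ (fun x => κ - radialWeight κ x) x x =
      2 * radialWeight κ x ^ 2 * ‖x‖ ^ 2 := by
    rw [fderiv_const_sub, neg_apply, fderiv_radialWeight hκ, real_inner_self_eq_norm_sq]
    ring
  have hN : inner ℝ (negProj (φ x)) (negProj (fderiv ℝ φ x x)) =
      inner ℝ (fderiv ℝ φ x x) (negProj (φ x)) := by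
    rw [real_inner_comm, ← inner_negProj]
  have hconn (i : Fin 4) := norm_add_sq_real (fderiv ℝ φ x (flatFrame κ i x)) (spinForm κ x i (φ x))
  have hdirac : flatDirac κ φ x = ∑ i, cliff i (fderiv ℝ φ x (flatFrame κ i x))
      + ∑ i, cliff i (spinForm κ x i (φ x)) := by
    simp only [flatDirac, flatConnection, map_add, Finset.sum_add_distrib]
  rw [hdN, hdw, hN, hdirac, norm_add_sq_real]
  simp only [flatConnection, hconn, Finset.sum_add_distrib, firstOrder, realCliff_apply,
    finrank_euclideanSpace_fin, ← Finset.mul_sum]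
  have hcross := sum_inner_spinForm hκ (fderiv ℝ φ x) x (φ x)
  rw [real_inner_comm] at hcross
  simp only [real_inner_comm (fderiv ℝ φ x _)] at hcross
  have hzero := sum_norm_spinForm_sq_sub hκ x (φ x)
  push_cast
  linear_combination -hcross - hzero

variable {φ : E4 → Spinor}

theorem sum_smul_flatConnection (hκ : 0 ≤ κ) (φ : E4 → Spinor) (x : E4) :
    ∑ i, x i • flatConnection κ i φ x = fderiv ℝ φ x x := by
  simp only [flatConnection, smul_add, Finset.sum_add_distrib, sum_smul_spinForm, add_zero,
    ← map_smul, ← map_sum, sum_smul_flatFrame hκ]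

theorem norm_fderiv_apply_self_sq_le (hκ : 0 ≤ κ) (φ : E4 → Spinor) (x : E4) :
    ‖fderiv ℝ φ x x‖ ^ 2 ≤ ‖x‖ ^ 2 * ∑ i, ‖flatConnection κ i φ x‖ ^ 2 := by
  rw [← sum_smul_flatConnection hκ, EuclideanSpace.norm_sq_eq x]
  have htriangle : ‖∑ i, x i • flatConnection κ i φ x‖ ≤ ∑ i, ‖x i‖ * ‖flatConnection κ i φ x‖ :=
    norm_sum_le_of_le _ fun i _ => (norm_smul _ _).le
  exact (pow_le_pow_left₀ (norm_nonneg _) htriangle 2).trans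
    (Finset.sum_mul_sq_le_sq_mul_sq _ _ _)

theorem continuous_flatDirac (hκ : 0 ≤ κ) (hφ : ContDiff ℝ ∞ φ) : Continuous (flatDirac κ φ) := by
  rw [funext (flatDirac_eq κ φ)]
  exact (continuous_firstOrder (fun i => (contDiff_flatFrame κ i).of_le (by simp)) hφ).add
    ((continuous_flatPotential hκ).clm_apply hφ.continuous)

theorem hasCompactSupport_flatDirac (κ : ℝ) (hφc : HasCompactSupport φ) :
    HasCompactSupport (flatDirac κ φ) :=
  .intro hφc fun x hx => by
    simp only [flatDirac_eq, firstOrder, image_eq_zero_of_notMem_tsupport hx,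
      image_eq_zero_of_notMem_tsupport fun h => hx (tsupport_fderiv_subset ℝ h), zero_apply,
      map_zero, Finset.sum_const_zero, add_zero]

theorem integral_inv_one_add_norm_sq_mul_le_flatDirac (hκ : 0 ≤ κ) (hφ : ContDiff ℝ ∞ φ)
    (hφc : HasCompactSupport φ) :
    ∫ x, (1 + ‖x‖ ^ 2)⁻¹ * ‖φ x‖ ^ 2 ≤ ∫ x, ‖flatDirac κ φ x‖ ^ 2 := by
  have hdiv := isTotalDivergence_flatDirac hκ (hφ.of_le ENat.LEInfty.out) hφc
  have hD : Integrable fun x => ‖flatDirac κ φ x‖ ^ 2 :=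
    (((continuous_flatDirac hκ hφ).memLp_of_hasCompactSupport
      (hasCompactSupport_flatDirac κ hφc)).integrable_norm_pow two_ne_zero)
  have hconn : Integrable fun x => ∑ i, ‖flatConnection κ i φ x‖ ^ 2 :=
    ((hdiv.integrable volume).add hD).congr (.of_forall fun x => sub_add_cancel _ _)
  calc ∫ x, (1 + ‖x‖ ^ 2)⁻¹ * ‖φ x‖ ^ 2 ≤ ∫ x, ∑ i, ‖flatConnection κ i φ x‖ ^ 2 :=
        integral_inv_one_add_norm_sq_mul_le volume
          (by rw [finrank_euclideanSpace_fin]) (hφ.of_le (mod_cast le_top)) hφc hconn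
          (fun x => by positivity) (norm_fderiv_apply_self_sq_le hκ φ)
    _ = ∫ x, ‖flatDirac κ φ x‖ ^ 2 := by
        rw [← sub_eq_zero, ← integral_sub hconn hD, hdiv.integral_eq_zero volume]

theorem eLpNorm_inv_sqrt_smul_le_flatDirac (hκ : 0 ≤ κ) (hφ : ContDiff ℝ ∞ φ)
    (hφc : HasCompactSupport φ) :
    eLpNorm (fun x => (√(1 + ‖x‖ ^ 2))⁻¹ • φ x) 2 ≤ eLpNorm (flatDirac κ φ) 2 := by
  have hq : Continuous fun x : E4 => (√(1 + ‖x‖ ^ 2))⁻¹ :=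
    (by fun_prop : Continuous fun x : E4 => √(1 + ‖x‖ ^ 2)).inv₀ fun x => by positivity
  have hqφ : MemLp (fun x => (√(1 + ‖x‖ ^ 2))⁻¹ • φ x) 2 :=
    (hq.smul hφ.continuous).memLp_of_hasCompactSupport hφc.smul_left
  have hD : MemLp (flatDirac κ φ) 2 :=
    (continuous_flatDirac hκ hφ).memLp_of_hasCompactSupport (hasCompactSupport_flatDirac κ hφc)
  rw [hqφ.eLpNorm_eq_integral_rpow_norm two_ne_zero ENNReal.ofNat_ne_top,
    hD.eLpNorm_eq_integral_rpow_norm two_ne_zero ENNReal.ofNat_ne_top]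
  have hnorm (x : E4) : ‖(√(1 + ‖x‖ ^ 2))⁻¹ • φ x‖ ^ 2 = (1 + ‖x‖ ^ 2)⁻¹ * ‖φ x‖ ^ 2 := by
    rw [norm_smul, mul_pow, norm_inv, inv_pow, Real.norm_of_nonneg (Real.sqrt_nonneg _),
      Real.sq_sqrt (by positivity)]
  simp only [ENNReal.toReal_ofNat, Real.rpow_two, hnorm]
  gcongr ENNReal.ofReal (?_ ^ _)
  exact integral_inv_one_add_norm_sq_mul_le_flatDirac hκ hφ hφc

end SpinConnection

/-! ### The weak Dirac equation -/

section Volume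
variable {a b : ℝ} (ha : 0 < a) (hb : 0 < b)
include ha hb

theorem det_kepler (x : E4) : (kepler a b (2 * b / a) (b ^ 2 / a ^ 2) x).det =
    (16 * a * (a + b * ‖x‖ ^ 2)) ^ 2 := by
  set t := (2 * b / a + b ^ 2 / a ^ 2 * ‖x‖ ^ 2) /
    (1 + 2 * b / a * ‖x‖ ^ 2 + b ^ 2 / a ^ 2 * (‖x‖ ^ 2) ^ 2) with ht
  have hrank : kepler a b (2 * b / a) (b ^ 2 / a ^ 2) x = (4 * (a + b * ‖x‖ ^ 2)) •
      (1 + Matrix.replicateCol Unit (-t • hopf x).ofLp * Matrix.replicateRow Unit (hopf x)) := by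
    ext i j
    simp [kepler, Matrix.mul_apply, Matrix.one_apply, ← ht, sub_eq_add_neg]
  have hdot : (hopf x).ofLp ⬝ᵥ (-t • hopf x).ofLp = -t * ‖x‖ ^ 2 := by
    rw [WithLp.ofLp_smul, dotProduct_smul, ← real_inner_self_eq_norm_sq, ← inner_hopf_hopf,
      real_inner_self_eq_norm_sq, EuclideanSpace.real_norm_sq_eq]
    simp [dotProduct, sq]
  have hm : a + b * ‖x‖ ^ 2 ≠ 0 := by positivity
  rw [hrank, Matrix.det_smul, Matrix.det_one_add_replicateCol_mul_replicateRow, hdot, ht,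
    kepler_den ha, Fintype.card_fin]
  field_simp
  ring

theorem vol_taubNUT : (taubNUT a b ha hb).vol =
    volume.withDensity fun x : E4 => ENNReal.ofReal (16 * a * (a + b * ‖x‖ ^ 2)) := by
  rw [RiemannianMetric.vol]
  congr 1
  ext x
  have hdet : ((taubNUT a b ha hb).toMatrix x).det = (16 * a * (a + b * ‖x‖ ^ 2)) ^ 2 :=
    det_kepler ha hb x
  rw [hdet, Real.sqrt_sq (by positivity)]

theorem integral_vol_taubNUT {F : Type*} [NormedAddCommGroup F] [NormedSpace ℝ F] (f : E4 → F) :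
    ∫ x, f x ∂(taubNUT a b ha hb).vol = ∫ x, (16 * a * (a + b * ‖x‖ ^ 2)) • f x := by
  rw [vol_taubNUT, integral_withDensity_eq_integral_toReal_smul (by fun_prop)
    (.of_forall fun x => ENNReal.ofReal_lt_top)]
  refine integral_congr_ae (.of_forall fun x => ?_)
  beta_reduce
  rw [ENNReal.toReal_ofReal (by positivity)]

theorem volume_le_smul_vol_taubNUT :
    volume ≤ (ENNReal.ofReal (16 * a * a))⁻¹ • (taubNUT a b ha hb).vol := by
  have hc : ENNReal.ofReal (16 * a * a) ≠ 0 := by simpa using by positivity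
  have hle : ENNReal.ofReal (16 * a * a) • (volume : Measure E4) ≤ (taubNUT a b ha hb).vol := by
    rw [vol_taubNUT, ← withDensity_const]
    refine withDensity_mono (.of_forall fun x => ENNReal.ofReal_le_ofReal ?_)
    gcongr
    exact le_add_of_nonneg_right (by positivity)
  calc volume = (ENNReal.ofReal (16 * a * a))⁻¹ • ENNReal.ofReal (16 * a * a) •
        (volume : Measure E4) := by
        rw [smul_smul, ENNReal.inv_mul_cancel hc ENNReal.ofReal_ne_top, one_smul]
    _ ≤ _ := by gcongr

end Volume

theorem inner_flatPotential_left (κ : ℝ) (x : E4) (u v : Spinor) :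
    inner ℂ (flatPotential κ x u) v =
      inner ℂ u (flatPotential κ x v - (radialWeight κ x - κ) • ∑ i, x i • cliff i v) := by
  have h (i : Fin 4) : inner ℂ (cliff i (negProj u)) v =
      inner ℂ u (cliff i (negProj v) - cliff i v) := by
    rw [inner_cliff_left, inner_negProj_left, negProj_cliff, ← inner_neg_right, neg_sub]
  simp only [flatPotential_apply, ← smul_sub, ← Finset.sum_sub_distrib,
    inner_smul_left_eq_star_smul, inner_smul_right_eq_smul, sum_inner, inner_sum, h, conj_trivial]

theorem inner_flatDirac_smul (κ : ℝ) {k : E4 → ℝ} {x : E4} (hk : DifferentiableAt ℝ k x)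
    (s v : Spinor) :
    inner ℂ (flatDirac κ (fun y => k y • s) x - radialWeight κ x • ∑ i, x i • cliff i (k x • s)) v =
      inner ℂ s (∑ i, -divergence (fun y => k y • flatFrame κ i y) x • realCliff i v
        + k x • flatPotential κ x v) := by
  have hd : HasFDerivAt (fun y => k y • s) _ x := hk.hasFDerivAt.smul_const s
  have hdiv (i : Fin 4) : divergence (fun y => k y • flatFrame κ i y) x =
      fderiv ℝ k x (flatFrame κ i x) - κ * k x * x i := by
    rw [divergence_smul hk ((contDiff_flatFrame κ i).differentiable (by simp) x),
      divergence_flatFrame]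
    ring
  rw [flatDirac_eq, firstOrder, hd.fderiv, map_smul]
  simp only [ContinuousLinearMap.smulRight_apply, map_smul, realCliff_apply, hdiv,
    inner_sub_left, inner_add_left, inner_add_right, inner_sub_right, inner_smul_left_eq_star_smul,
    inner_smul_right_eq_smul, sum_inner, inner_sum, inner_flatPotential_left, conj_trivial,
    inner_cliff_left, Finset.smul_sum]
  simp only [Fin.sum_univ_four]
  module

section Weak
variable {a b : ℝ} (ha : 0 < a) (hb : 0 < b)
include ha hb

theorem contDiff_frameScale : ContDiff ℝ ∞ (frameScale a b) := by
  have hm (x : E4) : a + b * ‖x‖ ^ 2 ≠ 0 := by positivity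
  have h : ContDiff ℝ ∞ fun x : E4 => a + b * ‖x‖ ^ 2 :=
    contDiff_const.add (contDiff_const.mul (contDiff_norm_sq ℝ))
  exact contDiff_const.div (contDiff_const.mul (h.sqrt hm)) fun x => by positivity

theorem dirac_frameScale_smul {φ : E4 → Spinor} {x : E4} (hφ : DifferentiableAt ℝ φ x) :
    (taubNUTFrame a b ha hb).dirac (fun y => frameScale a b y • φ y) x =
      (frameScale a b x ^ 2) •
        (flatDirac (b / a) φ x - radialWeight (b / a) x • ∑ i, x i • cliff i (φ x)) := by
  have hl := hasFDerivAt_frameScale ha hb x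
  have hd : HasFDerivAt (fun y => frameScale a b y • φ y) _ x := hl.smul hφ.hasFDerivAt
  have hfirst : firstOrder (flatFrame (b / a)) realCliff (fun y => frameScale a b y • φ y) x =
      frameScale a b x • (firstOrder (flatFrame (b / a)) realCliff φ x
        - radialWeight (b / a) x • ∑ i, x i • cliff i (φ x)) := by
    simp only [firstOrder, hd.fderiv, Finset.smul_sum, ← Finset.sum_sub_distrib]
    refine Finset.sum_congr rfl fun i _ => ?_
    simp only [add_apply, _root_.smul_apply, ContinuousLinearMap.smulRight_apply,
      innerSL_apply_apply, inner_flatFrame, map_add, map_smul, realCliff_apply]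
    module
  rw [dirac_taubNUTFrame, flatDirac_eq, flatDirac_eq, hfirst, map_smul]
  module

theorem inner_dirac_frameScale_smul {k : E4 → ℝ} {x : E4} (hk : DifferentiableAt ℝ k x)
    (s v : Spinor) :
    (16 * a * (a + b * ‖x‖ ^ 2)) • inner ℂ
        ((taubNUTFrame a b ha hb).dirac (fun y => frameScale a b y • k y • s) x) v =
      (4 * a) • inner ℂ s (∑ i, -divergence (fun y => k y • flatFrame (b / a) i y) x • realCliff i v
        + k x • flatPotential (b / a) x v) := by
  have hscale : 16 * a * (a + b * ‖x‖ ^ 2) * frameScale a b x ^ 2 = 4 * a := by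
    rw [frameScale, div_pow, mul_pow, Real.sq_sqrt (by positivity)]
    field_simp
    norm_num
  rw [dirac_frameScale_smul ha hb (hk.smul_const s), ← inner_flatDirac_smul (b / a) hk, ← hscale,
    inner_smul_left_eq_star_smul, conj_trivial, smul_smul]

theorem hasWeakImage_of_isWeakSolution {ψ : E4 → Spinor} (hψ : LocallyIntegrable ψ)
    (h : (taubNUTFrame a b ha hb).IsWeakSolution ψ) :
    HasWeakImage volume (flatFrame (b / a)) realCliff ψ
      fun x => -flatPotential (b / a) x (ψ x) := by
  intro k hk hkc
  have hκ : 0 ≤ b / a := by positivity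
  have hdiv : Integrable fun x => ∑ i,
      -divergence (fun y => k y • flatFrame (b / a) i y) x • realCliff i (ψ x) :=
    integrable_finsetSum _ fun i _ => by
      simpa only [neg_smul, Pi.neg_def] using (integrable_divergence_smul (hk.of_le (by simp)) hkc
        ((contDiff_flatFrame (b / a) i).of_le (by simp))
        (locallyIntegrable_clm_apply (continuous_const (y := realCliff i)) hψ)).neg
  have hpot : Integrable fun x => k x • flatPotential (b / a) x (ψ x) :=
    (locallyIntegrable_clm_apply (continuous_flatPotential hκ)
      hψ).integrable_smul_left_of_hasCompactSupport hk.continuous hkc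
  suffices hzero : ∫ x, (∑ i, -divergence (fun y => k y • flatFrame (b / a) i y) x •
      realCliff i (ψ x)) + k x • flatPotential (b / a) x (ψ x) = 0 by
    rw [integral_add hdiv hpot] at hzero
    simp only [smul_neg, integral_neg]
    exact eq_neg_of_add_eq_zero_left hzero
  refine ext_inner_left ℂ fun s => ?_
  have hφ : ContDiff ℝ ∞ fun y => k y • s := hk.smul contDiff_const
  have hweak := h (fun y => frameScale a b y • k y • s)
    (ContDiff.smul (f := frameScale a b) (contDiff_frameScale ha hb) hφ)
    (HasCompactSupport.smul_left (f := frameScale a b) hkc.smul_right)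
  rw [integral_vol_taubNUT] at hweak
  simp only [inner_dirac_frameScale_smul ha hb (hk.differentiable (by simp) _)] at hweak
  rw [integral_smul, smul_eq_zero_iff_right (by positivity)] at hweak
  rw [inner_zero_right, ← hweak]
  exact (integral_inner (hdiv.add hpot) s).symm

end Weak

section Cutoff
open Filter Topology

/-- The smooth radial cutoff at scale `R`: equal to `1` on the ball of radius `R`, supported in the
ball of radius `2 * R`. -/
def cutoff (R : ℝ) (x : E4) : ℝ := Real.smoothTransition (2 - ‖x‖ ^ 2 / R ^ 2)

theorem contDiff_cutoff (R : ℝ) : ContDiff ℝ ∞ (cutoff R) :=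
  Real.smoothTransition.contDiff.comp (contDiff_const.sub ((contDiff_norm_sq ℝ).div_const _))

theorem cutoff_eq_one {R : ℝ} (hR : 0 < R) {x : E4} (hx : ‖x‖ ≤ R) : cutoff R x = 1 := by
  refine Real.smoothTransition.one_of_one_le ?_
  have : ‖x‖ ^ 2 / R ^ 2 ≤ 1 := div_le_one_of_le₀ (by gcongr) (by positivity)
  linarith

theorem two_sub_neg_of_two_mul_lt {R t : ℝ} (hR : 0 < R) (ht : 2 * R < t) :
    2 - t ^ 2 / R ^ 2 < 0 := by
  rw [sub_neg, lt_div_iff₀ (by positivity)]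
  nlinarith

theorem hasCompactSupport_cutoff {R : ℝ} (hR : 0 < R) : HasCompactSupport (cutoff R) :=
  .intro (isCompact_closedBall 0 (2 * R)) fun x hx => by
    rw [mem_closedBall_zero_iff, not_le] at hx
    exact Real.smoothTransition.zero_of_nonpos (two_sub_neg_of_two_mul_lt hR hx).le

theorem tendsto_cutoff (x : E4) : Tendsto (fun n : ℕ => cutoff (n + 1) x) atTop (𝓝 1) := by
  refine tendsto_const_nhds.congr' ?_
  filter_upwards [eventually_ge_atTop ⌈‖x‖⌉₊] with n hn
  have hx : ‖x‖ ≤ n := Nat.ceil_le.1 hn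
  exact (cutoff_eq_one (by positivity) (by linarith)).symm

theorem deriv_smoothTransition_of_neg {t : ℝ} (ht : t < 0) : deriv Real.smoothTransition t = 0 := by
  have h : Real.smoothTransition =ᶠ[𝓝 t] fun _ => 0 := by
    filter_upwards [Iio_mem_nhds ht] with s hs
    exact Real.smoothTransition.zero_of_nonpos (le_of_lt hs)
  rw [h.deriv_eq, deriv_const]

theorem exists_deriv_smoothTransition_le :
    ∃ M : ℝ, ∀ t ∈ Set.Icc 0 2, |deriv Real.smoothTransition t| ≤ M :=
  isCompact_Icc.exists_bound_of_continuousOn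
    ((Real.smoothTransition.contDiff (n := 1)).continuous_deriv le_rfl).continuousOn

theorem fderiv_cutoff (R : ℝ) (x v : E4) : fderiv ℝ (cutoff R) x v =
    -(2 / R ^ 2) * deriv Real.smoothTransition (2 - ‖x‖ ^ 2 / R ^ 2) * inner ℝ x v := by
  have hT : HasDerivAt Real.smoothTransition _ (2 - ‖x‖ ^ 2 / R ^ 2) :=
    ((Real.smoothTransition.contDiff (n := 1)).differentiable one_ne_zero _).hasDerivAt
  have h : HasFDerivAt (fun y : E4 => 2 - ‖y‖ ^ 2 / R ^ 2)
      (-((R ^ 2)⁻¹ • (2 : ℝ) • innerSL ℝ x)) x := by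
    simpa only [div_eq_mul_inv] using ((hasFDerivAt_norm_sq x).mul_const (R ^ 2)⁻¹).const_sub 2
  have hcomp : HasFDerivAt (cutoff R) _ x := hT.comp_hasFDerivAt x h
  rw [hcomp.fderiv]
  simp only [_root_.smul_apply, neg_apply, innerSL_apply_apply, smul_eq_mul]
  ring

theorem norm_sum_fderiv_cutoff_smul_le {M : ℝ}
    (hM : ∀ t ∈ Set.Icc 0 2, |deriv Real.smoothTransition t| ≤ M) {R : ℝ} (hR : 0 < R) (κ : ℝ)
    (x : E4) (s : Spinor) :
    ‖∑ i, fderiv ℝ (cutoff R) x (flatFrame κ i x) • cliff i s‖ ≤ 4 * M / R * ‖s‖ := by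
  set t := 2 - ‖x‖ ^ 2 / R ^ 2 with ht
  have hM0 : 0 ≤ M := (abs_nonneg _).trans (hM 0 (by simp))
  have hsum : ∑ i, fderiv ℝ (cutoff R) x (flatFrame κ i x) • cliff i s =
      (-(2 / R ^ 2) * deriv Real.smoothTransition t) • ∑ i, x i • cliff i s := by
    simp only [fderiv_cutoff, inner_flatFrame, Finset.smul_sum, smul_smul, ← ht]
  have hnorm : ‖∑ i, x i • cliff i s‖ = ‖x‖ * ‖s‖ := by
    rw [← sq_eq_sq₀ (norm_nonneg _) (by positivity), norm_sum_smul_cliff_sq, mul_pow]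
  rw [hsum, norm_smul, hnorm]
  rcases lt_or_ge t 0 with ht0 | ht0
  · rw [deriv_smoothTransition_of_neg ht0, mul_zero, norm_zero, zero_mul]
    positivity
  have hx : ‖x‖ ≤ 2 * R := not_lt.1 fun h => ht0.not_gt (two_sub_neg_of_two_mul_lt hR h)
  have ht2 : t ≤ 2 := sub_le_self _ (by positivity)
  calc ‖-(2 / R ^ 2) * deriv Real.smoothTransition t‖ * (‖x‖ * ‖s‖)
      ≤ 2 / R ^ 2 * M * (2 * R * ‖s‖) := by
        rw [norm_mul, norm_neg, Real.norm_of_nonneg (by positivity : 0 ≤ 2 / R ^ 2)]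
        gcongr
        exact hM t ⟨ht0, ht2⟩
    _ = 4 * M / R * ‖s‖ := by
        field_simp
        ring

end Cutoff

theorem ae_eq_zero_of_hasWeakImage {κ : ℝ} (hκ : 0 ≤ κ) {ψ : E4 → Spinor}
    (hψm : StronglyMeasurable ψ) (hψ : MemLp ψ 2) (h : HasWeakImage volume (flatFrame κ) realCliff ψ
      fun x => -flatPotential κ x (ψ x)) : ψ =ᵐ[volume] 0 := by
  obtain ⟨M, hM⟩ := exists_deriv_smoothTransition_le
  let q (x : E4) : ℝ := (√(1 + ‖x‖ ^ 2))⁻¹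
  have hq : Continuous q := (by fun_prop : Continuous fun x : E4 => √(1 + ‖x‖ ^ 2)).inv₀
    fun x => by positivity
  have hq0 (x : E4) : q x ≠ 0 := inv_ne_zero (by positivity)
  have hq1 (x : E4) : |q x| ≤ 1 := by
    rw [abs_of_nonneg (by positivity)]
    exact inv_le_one_of_one_le₀ (Real.one_le_sqrt.2 (le_add_of_nonneg_right (by positivity)))
  have hest (φ : E4 → Spinor) (hφ : ContDiff ℝ ∞ φ) (hφc : HasCompactSupport φ) :
      eLpNorm (fun x => q x • φ x) 2 ≤
        eLpNorm (fun x => firstOrder (flatFrame κ) realCliff φ x + flatPotential κ x (φ x)) 2 := by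
    simp only [← flatDirac_eq]
    exact eLpNorm_inv_sqrt_smul_le_flatDirac hκ hφ hφc
  have hδ : Filter.Tendsto (fun n : ℕ => 4 * M / ((n : ℝ) + 1)) Filter.atTop (nhds 0) :=
    (Filter.tendsto_atTop_add_const_right _ 1 tendsto_natCast_atTop_atTop).const_div_atTop _
  exact h.ae_eq_zero (fun i => (contDiff_flatFrame κ i).of_le (by simp))
    (continuous_flatPotential hκ) hq hq0 hq1 hest (fun n => contDiff_cutoff (n + 1))
    (fun n => hasCompactSupport_cutoff (by positivity)) tendsto_cutoff hδ
    (fun n => norm_sum_fderiv_cutoff_smul_le hM (by positivity) κ) hψm hψ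

section Weak
variable {a b : ℝ} (ha : 0 < a) (hb : 0 < b) {ψ : E4 → Spinor}
include ha hb

theorem ae_eq_zero_of_isWeakSolution (hψ : MemLp ψ 2 (taubNUT a b ha hb).vol)
    (h : (taubNUTFrame a b ha hb).IsWeakSolution ψ) : ψ =ᵐ[(taubNUT a b ha hb).vol] 0 := by
  have hac : (taubNUT a b ha hb).vol ≪ volume := by
    rw [vol_taubNUT]
    exact withDensity_absolutelyContinuous _ _
  have hvol : MemLp ψ 2 := hψ.of_measure_le_smul
    (ENNReal.inv_ne_top.2 (by simpa using by positivity)) (volume_le_smul_vol_taubNUT ha hb)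
  obtain ⟨u, hum, hψu⟩ := hvol.aestronglyMeasurable
  have hu : MemLp u 2 := (memLp_congr_ae hψu).1 hvol
  have hweak : (taubNUTFrame a b ha hb).IsWeakSolution u := fun φ hφ hφc => by
    rw [← h φ hφ hφc]
    refine integral_congr_ae ?_
    filter_upwards [hac.ae_eq hψu] with x hx
    rw [hx]
  exact hac.ae_eq (hψu.trans (ae_eq_zero_of_hasWeakImage (div_pos hb ha).le hum hu
    (hasWeakImage_of_isWeakSolution ha hb (hu.locallyIntegrable one_le_two) hweak)))

theorem chiralKernel_eq_bot (s : ℂ) : (taubNUTFrame a b ha hb).chiralKernel s = ⊥ :=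
  (Submodule.eq_bot_iff _).2 fun ψ hψ => Lp.eq_zero_iff_ae_eq_zero.2
    (ae_eq_zero_of_isWeakSolution ha hb (Lp.memLp ψ) hψ.1)

end Weak

end TaubNUT

end

theorem theorem1 (a b : ℝ) (ha : 0 < a) (hb : 0 < b) :
    (∀ ψ : TaubNUT.E4 → TaubNUT.Spinor,
      MeasureTheory.MemLp ψ 2 (TaubNUT.taubNUT a b ha hb).vol →
      (TaubNUT.taubNUTFrame a b ha hb).IsWeakSolution ψ →
      ψ =ᵐ[(TaubNUT.taubNUT a b ha hb).vol] 0) ∧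
    FiniteDimensional ℂ ((TaubNUT.taubNUTFrame a b ha hb).chiralKernel 1) ∧
    FiniteDimensional ℂ ((TaubNUT.taubNUTFrame a b ha hb).chiralKernel (-1)) ∧
    (TaubNUT.taubNUTFrame a b ha hb).l2Index = 0 := by
  have h := TaubNUT.chiralKernel_eq_bot ha hb
  refine ⟨fun ψ hψ hw => TaubNUT.ae_eq_zero_of_isWeakSolution ha hb hψ hw, ?_, ?_, ?_⟩
  · rw [h]
    infer_instance
  · rw [h]
    infer_instance
  · rw [TaubNUT.OrthonormalFrame.l2Index, h, h]
    simp
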